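/- Let $m,n\ge 1$. For a field $K$, $q\in K^\times$ and $v_1,\dots,v_m\in K^\times$, let $H(m,1,n)$ be the cyclotomic Hecke algebra: the associative unital $K$-algebra generated by $\tau,\sigma_1,\dots,\sigma_{n-1}$ with the relations $$\sigma_i\sigma_{i+1}\sigma_i=\sigma_{i+1}\sigma_i\sigma_{i+1},\qquad \sigma_i\sigma_j=\sigma_j\sigma_i\ (|i-j|>1),\qquad \tau\sigma_1\tau\sigma_1=\sigma_1\tau\sigma_1\tau,\qquad \tau\sigma_i=\sigma_i\tau\ (i>1),$$ $$\sigma_i^2=(q-q^{-1})\sigma_i+1,\qquad (\tau-v_1)\cdots(\tau-v_m)=0 .$$ For $k\le n$ there is the natural homomorphism $H(m,1,k)\to H(m,1,n)$ that sends each generator to the generator of the same name. The Jucys--Murphy elements of $H(m,1,n)$ are $J_1=\tau$, $J_{i+1}=\sigma_iJ_i\sigma_i$, $i=1,\dots,n-1$. Assume one of the following. 1. (Semisimple case.) $K=\mathbb C$, all $v_j\ne 0$, $q\neq 0$, $1+q^2+\dots+q^{2N}\ne 0$ for all integers $0\le N<n$, $q^{2i}v_j-v_k\neq 0$ for all $j\ne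 k$ and all integers $-n<i<n$, and, if $n\ge 2$, $q^2\neq 1$. 2. (Generic case.) $K=\mathbb C(q,v_1,\dots,v_m)$ is the field of rational functions in the indeterminates $q,v_1,\dots,v_m$. Then: (a) The Jucys--Murphy elements distinguish basis elements in the sum of all irreducible representations of $H(m,1,n)$: every irreducible representation has a $K$-basis of common eigenvectors of $J_1,\dots,J_n$; different vectors of this basis have different strings of eigenvalues $(a_1,\dots,a_n)$; and non-isomorphic irreducible representations have no string of eigenvalues in common. (b) The set $\{J_1,\dots,J_n\}$ is maximal commutative in $H(m,1,n)$: the subalgebra $K[J_1,\dots,J_n]$ that it generates is commutative and is contained in no strictly larger commutative subalgebra. (c) $K[J_1,\dots,J_n]$ coincides with the subalgebra of $H(m,1,n)$ generated by the union of (the images of) the centres of $H(m,1,k)$, $k=1,\dots,n$. -/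

import Mathlib

noncomputable section

namespace CyclotomicHecke

/-- The generators of `H(m,1,n)`: the element `τ` and the elements `σ₁, …, σₙ₋₁`.
Here `sigma i h` stands for `σᵢ₊₁`, so `i` runs over `0, …, n - 2`. -/
inductive Gen (n : ℕ) : Type
  | tau : Gen n
  | sigma (i : ℕ) (h : i + 1 < n) : Gen n

section Algebra

variable (K : Type*) [Field K]

/-- `τ` in the free associative algebra. -/
def freeTau (n : ℕ) : FreeAlgebra K (Gen n) := FreeAlgebra.ι K Gen.tau

/-- `σᵢ₊₁` in the free associative algebra. -/
def freeSigma {n : ℕ} (i : ℕ) (h : i + 1 < n) : FreeAlgebra K (Gen n) :=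
  FreeAlgebra.ι K (Gen.sigma i h)

variable {K} {m : ℕ}

/-- The defining relations of the cyclotomic Hecke algebra `H(m,1,n)` with parameters
`q` and `v₁, …, vₘ`. -/
inductive Rel (q : K) (v : Fin m → K) (n : ℕ) :
    FreeAlgebra K (Gen n) → FreeAlgebra K (Gen n) → Prop
  /-- `σᵢ σᵢ₊₁ σᵢ = σᵢ₊₁ σᵢ σᵢ₊₁` -/
  | braid (i : ℕ) (h : i + 1 < n) (h' : i + 1 + 1 < n) : Rel q v n
      (freeSigma K i h * freeSigma K (i + 1) h' * freeSigma K i h)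
      (freeSigma K (i + 1) h' * freeSigma K i h * freeSigma K (i + 1) h')
  /-- `σᵢ σⱼ = σⱼ σᵢ` for `|i - j| > 1` -/
  | sigma_comm (i j : ℕ) (hi : i + 1 < n) (hj : j + 1 < n) (hij : i + 1 < j) : Rel q v n
      (freeSigma K i hi * freeSigma K j hj)
      (freeSigma K j hj * freeSigma K i hi)
  /-- `τ σ₁ τ σ₁ = σ₁ τ σ₁ τ` -/
  | tau_braid (h : 0 + 1 < n) : Rel q v n
      (freeTau K n * freeSigma K 0 h * freeTau K n * freeSigma K 0 h)
      (freeSigma K 0 h * freeTau K n * freeSigma K 0 h * freeTau K n)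
  /-- `τ σᵢ = σᵢ τ` for `i > 1` -/
  | tau_comm (i : ℕ) (h : i + 1 < n) (hi : 0 < i) : Rel q v n
      (freeTau K n * freeSigma K i h)
      (freeSigma K i h * freeTau K n)
  /-- `σᵢ² = (q - q⁻¹) σᵢ + 1` -/
  | quadratic (i : ℕ) (h : i + 1 < n) : Rel q v n
      (freeSigma K i h ^ 2)
      ((q - q⁻¹) • freeSigma K i h + 1)
  /-- `(τ - v₁) ⋯ (τ - vₘ) = 0` -/
  | cyclotomic : Rel q v n
      (Polynomial.aeval (freeTau K n) (∏ j : Fin m, (Polynomial.X - Polynomial.C (v j))))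
      0

/-- The cyclotomic Hecke algebra `H(m,1,n)` over the field `K` (for `n ≥ 1`), with parameters
`q` and `v₁, …, vₘ`. -/
abbrev H (q : K) (v : Fin m → K) (n : ℕ) : Type _ := RingQuot (Rel q v n)

variable (q : K) (v : Fin m → K)

/-- The generator `τ` of `H(m,1,n)`. -/
def tau (n : ℕ) : H q v n := RingQuot.mkAlgHom K (Rel q v n) (freeTau K n)

/-- The generator `σᵢ₊₁` of `H(m,1,n)`. -/
def sigma {n : ℕ} (i : ℕ) (h : i + 1 < n) : H q v n :=
  RingQuot.mkAlgHom K (Rel q v n) (freeSigma K i h)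

/-- The Jucys–Murphy elements: `jucysMurphy q v i h` is `Jᵢ₊₁`, where
`J₁ = τ` and `Jᵢ₊₁ = σᵢ Jᵢ σᵢ`. -/
def jucysMurphy {n : ℕ} : (i : ℕ) → i < n → H q v n
  | 0, _ => tau q v n
  | i + 1, h => sigma q v i h * jucysMurphy i (Nat.lt_of_succ_lt h) * sigma q v i h

/-- The set `{J₁, …, Jₙ}` of Jucys–Murphy elements of `H(m,1,n)`. -/
def jucysMurphySet (n : ℕ) : Set (H q v n) :=
  Set.range fun i : Fin n => jucysMurphy q v i.1 i.2

/-- The images of the generators of `H(m,1,k)` in `H(m,1,n)`, for `k ≤ n`. -/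
def genMap {k n : ℕ} (hkn : k ≤ n) : Gen k → H q v n
  | Gen.tau => tau q v n
  | Gen.sigma i h => sigma q v i (h.trans_le hkn)

@[simp] theorem lift_freeTau {k n : ℕ} (hkn : k ≤ n) :
    FreeAlgebra.lift K (genMap q v hkn) (freeTau K k) = tau q v n := by
  simp [freeTau, genMap]

@[simp] theorem lift_freeSigma {k n : ℕ} (hkn : k ≤ n) (i : ℕ) (h : i + 1 < k) :
    FreeAlgebra.lift K (genMap q v hkn) (freeSigma K i h) = sigma q v i (h.trans_le hkn) := by
  simp [freeSigma, genMap]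

theorem lift_rel {k n : ℕ} (hkn : k ≤ n) ⦃x y : FreeAlgebra K (Gen k)⦄ (hxy : Rel q v k x y) :
    FreeAlgebra.lift K (genMap q v hkn) x = FreeAlgebra.lift K (genMap q v hkn) y := by
  cases hxy with
  | braid i h h' =>
    simpa [sigma] using RingQuot.mkAlgHom_rel K
      (Rel.braid (q := q) (v := v) i (h.trans_le hkn) (h'.trans_le hkn))
  | sigma_comm i j hi hj hij =>
    simpa [sigma] using RingQuot.mkAlgHom_rel K
      (Rel.sigma_comm (q := q) (v := v) i j (hi.trans_le hkn) (hj.trans_le hkn) hij)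
  | tau_braid h =>
    simpa [sigma, tau] using RingQuot.mkAlgHom_rel K
      (Rel.tau_braid (q := q) (v := v) (h.trans_le hkn))
  | tau_comm i h hi =>
    simpa [sigma, tau] using RingQuot.mkAlgHom_rel K
      (Rel.tau_comm (q := q) (v := v) i (h.trans_le hkn) hi)
  | quadratic i h =>
    simpa [sigma] using RingQuot.mkAlgHom_rel K
      (Rel.quadratic (q := q) (v := v) i (h.trans_le hkn))
  | cyclotomic =>
    have := RingQuot.mkAlgHom_rel K (Rel.cyclotomic (q := q) (v := v) (n := n))
    rw [← Polynomial.aeval_algHom_apply, map_zero] at this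
    rw [← Polynomial.aeval_algHom_apply, map_zero, lift_freeTau]
    exact this

/-- The natural homomorphism `H(m,1,k) → H(m,1,n)` for `k ≤ n`, sending each generator to the
generator of the same name. -/
def incl {k n : ℕ} (hkn : k ≤ n) : H q v k →ₐ[K] H q v n :=
  RingQuot.liftAlgHom K ⟨FreeAlgebra.lift K (genMap q v hkn), lift_rel q v hkn⟩

/-- The subalgebra of `H(m,1,n)` generated by the union of the centres of `H(m,1,k)`,
`k = 1, …, n`. -/
def centresSubalgebra (n : ℕ) : Subalgebra K (H q v n) :=
  Algebra.adjoin K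
    {x | ∃ (k : ℕ) (_ : 1 ≤ k) (hkn : k ≤ n), ∃ z ∈ Subalgebra.center K (H q v k),
      incl q v hkn z = x}

end Algebra

/-- A subset `S` of an algebra is a maximal commutative set if the subalgebra it generates (the
polynomials in the elements of `S`) is maximal among the commutative subalgebras. -/
def IsMaximalCommutativeSet (K : Type*) {A : Type*} [Field K] [Ring A] [Algebra K A]
    (S : Set A) : Prop :=
  Maximal (fun B : Subalgebra K A => ∀ x ∈ B, ∀ y ∈ B, x * y = y * x) (Algebra.adjoin K S)

/-- The Jucys–Murphy elements distinguish the basis elements in the sum of all irreducible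
representations of `H(m,1,n)`: every irreducible representation has a basis of common eigenvectors
of `J₁, …, Jₙ`; the strings of eigenvalues of different basis vectors are different; and a string
of eigenvalues that occurs in two irreducible representations forces them to be isomorphic. -/
def JucysMurphyDistinguish {K : Type} [Field K] {m : ℕ} (q : K) (v : Fin m → K) (n : ℕ) : Prop :=
  (∀ (V : Type) [AddCommGroup V] [Module K V] [Module (H q v n) V]
      [IsScalarTower K (H q v n) V] [IsSimpleModule (H q v n) V],
    ∃ (ι : Type) (b : Module.Basis ι K V) (a : ι → Fin n → K), Function.Injective a ∧
      ∀ (t : ι) (i : Fin n), jucysMurphy q v i.1 i.2 • b t = a t i • b t) ∧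
  (∀ (V W : Type) [AddCommGroup V] [Module K V] [Module (H q v n) V]
      [IsScalarTower K (H q v n) V] [IsSimpleModule (H q v n) V]
      [AddCommGroup W] [Module K W] [Module (H q v n) W]
      [IsScalarTower K (H q v n) W] [IsSimpleModule (H q v n) W]
      (a : Fin n → K) (x : V) (y : W), x ≠ 0 → y ≠ 0 →
      (∀ i : Fin n, jucysMurphy q v i.1 i.2 • x = a i • x) →
      (∀ i : Fin n, jucysMurphy q v i.1 i.2 • y = a i • y) →
      Nonempty (V ≃ₗ[H q v n] W))

/-- The field `ℂ(q, v₁, …, vₘ)` of rational functions in `m + 1` indeterminates; the variable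
`none` is `q` and the variable `some j` is `vⱼ`. -/
abbrev GenericField (m : ℕ) : Type := FractionRing (MvPolynomial (Option (Fin m)) ℂ)

/-- The indeterminate `q` of `ℂ(q, v₁, …, vₘ)`. -/
def genericQ (m : ℕ) : GenericField m :=
  algebraMap (MvPolynomial (Option (Fin m)) ℂ) (GenericField m) (MvPolynomial.X none)

/-- The indeterminates `vⱼ` of `ℂ(q, v₁, …, vₘ)`. -/
def genericV (m : ℕ) (j : Fin m) : GenericField m :=
  algebraMap (MvPolynomial (Option (Fin m)) ℂ) (GenericField m) (MvPolynomial.X (some j))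

/-- The restrictions on numerical parameters `q`, `v₁, …, vₘ` in the semisimple situation. -/
structure SemisimpleParameters {m : ℕ} (q : ℂ) (v : Fin m → ℂ) (n : ℕ) : Prop where
  q_ne_zero : q ≠ 0
  /-- `1 + q² + ⋯ + q²ᴺ ≠ 0` for all `N < n` -/
  sum_ne_zero : ∀ N : ℕ, N < n → ∑ i ∈ Finset.range (N + 1), q ^ (2 * i) ≠ 0
  /-- `q²ⁱ vⱼ - vₖ ≠ 0` for all `j ≠ k` and `-n < i < n` -/
  sub_ne_zero : ∀ i : ℤ, -(n : ℤ) < i → i < (n : ℤ) → ∀ j k : Fin m, j ≠ k →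
    q ^ (2 * i) * v j - v k ≠ 0
  v_ne_zero : ∀ j, v j ≠ 0

end CyclotomicHecke

end

/-!
Write `Q = q²`. The intertwiner `σᵢ Jᵢ - Jᵢ σᵢ` exchanges the eigenvalues `c`, `d` of `Jᵢ` and
`Jᵢ₊₁` on a common eigenvector, and its square vanishes there only if `c = Q d` or `d = Q c`. Moving
eigenvalues past each other with intertwiners shows that a string of joint eigenvalues of
`J₁, …, Jₙ` is the string of contents of a standard multitableau, provided that the previous
Jucys–Murphy elements are diagonalizable. For separated parameters two addable nodes do not have
neighbouring contents, which in turn excludes Jordan blocks of the next Jucys–Murphy element.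

Multiplicity one comes from `Hₖ₊₁ = Hₖ K[Jₖ₊₁] + Hₖ σₖ Hₖ`. On a joint eigenvector `x`, the element
`Jₖ₊₁` acts on `Hₖ x` by a scalar, and modulo `Hₖ x` the intertwiner moves `σₖ x` to a different
eigenvalue. Hence the eigenspace of `Jₖ₊₁` in `Hₖ₊₁ x` that contains `x` is `Hₖ x`, and by descent
the joint eigenspace of `x` in `Hₙ x` is a line. So a simple module is determined by any one of its
strings of eigenvalues, and everything that commutes with `J₁, …, Jₙ` is a polynomial in them. As
`J₁ + ⋯ + Jₖ` is central in `Hₖ`, these polynomials are also generated by the centres.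
-/

noncomputable section

namespace CyclotomicHecke

open Polynomial

section Relations

variable {K : Type*} [Field K] {m n : ℕ} (q : K) (v : Fin m → K)

/-- The generator `σᵢ₊₁` of `H(m,1,n)`, extended by zero to all indices `i`. -/
def sig (n i : ℕ) : H q v n := if h : i + 1 < n then sigma q v i h else 0

/-- The Jucys–Murphy element `Jᵢ₊₁` of `H(m,1,n)`, extended by zero to all indices `i`. -/
def jm (n i : ℕ) : H q v n := if h : i < n then jucysMurphy q v i h else 0

theorem sig_of_lt {i : ℕ} (h : i + 1 < n) : sig q v n i = sigma q v i h := dif_pos h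

theorem jm_of_lt {i : ℕ} (h : i < n) : jm q v n i = jucysMurphy q v i h := dif_pos h

theorem jm_zero (hn : 0 < n) : jm q v n 0 = tau q v n := by
  rw [jm_of_lt q v hn, jucysMurphy]

theorem jm_succ {i : ℕ} (h : i + 1 < n) :
    jm q v n (i + 1) = sig q v n i * jm q v n i * sig q v n i := by
  rw [jm_of_lt q v h, jm_of_lt q v (Nat.lt_of_succ_lt h), sig_of_lt q v h, jucysMurphy]

theorem sig_mul_self {i : ℕ} (h : i + 1 < n) :
    sig q v n i * sig q v n i = (q - q⁻¹) • sig q v n i + 1 := by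
  rw [sig_of_lt q v h, ← sq]
  simpa [sigma] using RingQuot.mkAlgHom_rel K (Rel.quadratic (q := q) (v := v) i h)

theorem sig_braid {i : ℕ} (h : i + 2 < n) :
    sig q v n i * sig q v n (i + 1) * sig q v n i =
      sig q v n (i + 1) * sig q v n i * sig q v n (i + 1) := by
  rw [sig_of_lt q v h, sig_of_lt q v (Nat.lt_of_succ_lt h)]
  simpa [sigma] using RingQuot.mkAlgHom_rel K
    (Rel.braid (q := q) (v := v) i (Nat.lt_of_succ_lt h) h)

theorem commute_sig_sig {i j : ℕ} (hj : j + 1 < n) (hij : i + 1 < j) :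
    Commute (sig q v n i) (sig q v n j) := by
  have hi : i + 1 < n := by omega
  rw [sig_of_lt q v hi, sig_of_lt q v hj, commute_iff_eq]
  simpa [sigma] using RingQuot.mkAlgHom_rel K
    (Rel.sigma_comm (q := q) (v := v) i j hi hj hij)

theorem commute_tau_sig {i : ℕ} (h : i + 1 < n) (hi : 0 < i) :
    Commute (tau q v n) (sig q v n i) := by
  rw [sig_of_lt q v h, commute_iff_eq]
  simpa [sigma, tau] using RingQuot.mkAlgHom_rel K (Rel.tau_comm (q := q) (v := v) i h hi)

theorem commute_tau_jm_one (hn : 1 < n) : Commute (tau q v n) (jm q v n 1) := by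
  rw [jm_succ q v hn, jm_zero q v (Nat.zero_lt_of_lt hn), sig_of_lt q v hn, commute_iff_eq]
  simpa [sigma, tau, mul_assoc] using
    RingQuot.mkAlgHom_rel K (Rel.tau_braid (q := q) (v := v) hn)

theorem commute_sig_jm_of_lt {i j : ℕ} (hi : i + 1 < n) (hj : j < i) :
    Commute (sig q v n i) (jm q v n j) := by
  induction j with
  | zero =>
    rw [jm_zero q v (by omega)]
    exact (commute_tau_sig q v hi hj).symm
  | succ j ih =>
    rw [jm_succ q v (by omega)]
    have hs : Commute (sig q v n i) (sig q v n j) := (commute_sig_sig q v hi hj).symm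
    exact (hs.mul_right (ih (by omega))).mul_right hs

theorem commute_sig_jm_add_two {i : ℕ} (hi : i + 2 < n) :
    Commute (sig q v n i) (jm q v n (i + 2)) := by
  have braid := sig_braid q v hi
  have comm : sig q v n (i + 1) * jm q v n i = jm q v n i * sig q v n (i + 1) :=
    commute_sig_jm_of_lt q v hi (Nat.lt_succ_self i)
  rw [jm_succ q v hi, jm_succ q v (Nat.lt_of_succ_lt hi)]
  set s := sig q v n i
  set t := sig q v n (i + 1)
  set X := jm q v n i
  calc s * (t * (s * X * s) * t) = (s * t * s) * X * (s * t) := by simp only [mul_assoc]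
    _ = t * s * (t * X) * (s * t) := by rw [braid]; simp only [mul_assoc]
    _ = t * s * X * (t * s * t) := by rw [comm]; simp only [mul_assoc]
    _ = t * (s * X * s) * t * s := by rw [← braid]; simp only [mul_assoc]

theorem commute_sig_jm_of_gt {i j : ℕ} (hj : j < n) (hij : i + 1 < j) :
    Commute (sig q v n i) (jm q v n j) := by
  induction j, hij using Nat.le_induction with
  | base => exact commute_sig_jm_add_two q v hj
  | succ j hij ih =>
    have hs : Commute (sig q v n i) (sig q v n j) := commute_sig_sig q v hj hij
    rw [jm_succ q v hj]
    exact (hs.mul_right (ih (Nat.lt_of_succ_lt hj))).mul_right hs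

theorem commute_tau_jm {j : ℕ} (hj : j + 1 < n) : Commute (tau q v n) (jm q v n (j + 1)) := by
  induction j with
  | zero => exact commute_tau_jm_one q v hj
  | succ j ih =>
    have hs : Commute (tau q v n) (sig q v n (j + 1)) := commute_tau_sig q v hj j.succ_pos
    rw [jm_succ q v hj]
    exact (hs.mul_right (ih (Nat.lt_of_succ_lt hj))).mul_right hs

theorem commute_jm_of_lt {i j : ℕ} (hj : j < n) (hij : i < j) :
    Commute (jm q v n i) (jm q v n j) := by
  induction i with
  | zero =>
    rw [jm_zero q v (Nat.zero_lt_of_lt hj)]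
    obtain ⟨j, rfl⟩ := Nat.exists_eq_succ_of_ne_zero hij.ne'
    exact commute_tau_jm q v hj
  | succ i ih =>
    rw [jm_succ q v (hij.trans hj)]
    have hs := commute_sig_jm_of_gt q v hj hij
    exact (hs.mul_left (ih (Nat.lt_of_succ_lt hij))).mul_left hs

theorem commute_jm {i j : ℕ} (hi : i < n) (hj : j < n) : Commute (jm q v n i) (jm q v n j) := by
  rcases lt_trichotomy i j with hij | rfl | hij
  · exact commute_jm_of_lt q v hj hij
  · exact Commute.refl _
  · exact (commute_jm_of_lt q v hi hij).symm

theorem aeval_jm_zero (hn : 0 < n) : aeval (jm q v n 0) (∏ j, (X - C (v j))) = 0 := by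
  have cyclotomic := RingQuot.mkAlgHom_rel K (Rel.cyclotomic (q := q) (v := v) (n := n))
  rwa [← aeval_algHom_apply, map_zero, ← tau, ← jm_zero q v hn] at cyclotomic

theorem adjoin_jm_zero_sig (hn : 0 < n) :
    Algebra.adjoin K (insert (jm q v n 0) (sig q v n '' {i | i + 1 < n})) = ⊤ := by
  have generate : Algebra.adjoin K (RingQuot.mkAlgHom K (Rel q v n) '' Set.range
      (FreeAlgebra.ι K)) = ⊤ := by
    rw [← AlgHom.map_adjoin, FreeAlgebra.adjoin_range_ι, Algebra.map_top]
    exact (AlgHom.range_eq_top _).2 (RingQuot.mkAlgHom_surjective K (Rel q v n))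
  rw [eq_top_iff, ← generate]
  refine Algebra.adjoin_mono ?_
  rintro _ ⟨_, ⟨g, rfl⟩, rfl⟩
  cases g with
  | tau => exact Or.inl (jm_zero q v hn).symm
  | sigma i h => exact Or.inr ⟨i, h, sig_of_lt q v h⟩

end Relations

/-! ### Jucys–Murphy systems and intertwiners -/

section JMSystem

variable {K A : Type*} [Field K] [Ring A] [Algebra K A] {m n : ℕ}

/-- Generators `s i` and commuting elements `J i` of an algebra that satisfy the relations between
the generators `σᵢ₊₁` and the Jucys–Murphy elements `Jᵢ₊₁` of `H(m,1,n)`, and generate the algebra.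
Only the `s i` with `i + 1 < n` and the `J i` with `i < n` are constrained. -/
structure IsJMSystem (q : K) (v : Fin m → K) (n : ℕ) (s J : ℕ → A) : Prop where
  s_mul_self : ∀ i, i + 1 < n → s i * s i = (q - q⁻¹) • s i + 1
  braid : ∀ i, i + 2 < n → s i * s (i + 1) * s i = s (i + 1) * s i * s (i + 1)
  commute_s : ∀ i j, j + 1 < n → i + 1 < j → Commute (s i) (s j)
  J_succ : ∀ i, i + 1 < n → J (i + 1) = s i * J i * s i
  commute_s_J : ∀ i j, i + 1 < n → j < n → j ≠ i → j ≠ i + 1 → Commute (s i) (J j)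
  commute_J : ∀ i j, i < n → j < n → Commute (J i) (J j)
  cyclotomic : aeval (J 0) (∏ j, (X - C (v j))) = 0
  generate : Algebra.adjoin K (insert (J 0) (s '' {i | i + 1 < n})) = ⊤

theorem isJMSystem_sig_jm (q : K) (v : Fin m → K) (hn : 0 < n) :
    IsJMSystem q v n (sig q v n) (jm q v n) where
  s_mul_self _ h := sig_mul_self q v h
  braid _ h := sig_braid q v h
  commute_s _ _ hj hij := commute_sig_sig q v hj hij
  J_succ _ h := jm_succ q v h
  commute_s_J i j hi hj hji hji' := by
    rcases Nat.lt_or_ge j i with h | h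
    · exact commute_sig_jm_of_lt q v hi h
    · exact commute_sig_jm_of_gt q v hj (by omega)
  commute_J _ _ hi hj := commute_jm q v hi hj
  cyclotomic := aeval_jm_zero q v hn
  generate := adjoin_jm_zero_sig q v hn

/-- The intertwiner `σᵢ₊₁ Jᵢ₊₁ - Jᵢ₊₁ σᵢ₊₁`, which exchanges the eigenvalues of `Jᵢ₊₁` and
`Jᵢ₊₂`. -/
def inter (s J : ℕ → A) (i : ℕ) : A := s i * J i - J i * s i

variable {q : K} {v : Fin m → K} {s J : ℕ → A} {i : ℕ}

namespace IsJMSystem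

theorem J_mul_s (hS : IsJMSystem q v n s J) (hi : i + 1 < n) :
    J i * s i = s i * J (i + 1) - (q - q⁻¹) • J (i + 1) := by
  rw [eq_sub_iff_add_eq, hS.J_succ i hi, mul_assoc (s i) (J i), ← mul_assoc (s i) (s i),
    hS.s_mul_self i hi, add_mul, one_mul, smul_mul_assoc, add_comm]

theorem s_mul_J_mul_s_mul_J (hS : IsJMSystem q v n s J) (hi : i + 1 < n) :
    s i * J i * s i * J i = J i * s i * J i * s i := by
  have comm := hS.commute_J (i + 1) i hi (Nat.lt_of_succ_lt hi)
  rw [hS.J_succ i hi, commute_iff_eq] at comm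
  simpa only [mul_assoc] using comm

theorem inter_mul_J (hS : IsJMSystem q v n s J) (hi : i + 1 < n) :
    inter s J i * J i = J (i + 1) * inter s J i := by
  have sq := hS.s_mul_self i hi
  have comm := hS.s_mul_J_mul_s_mul_J hi
  rw [hS.J_succ i hi, inter]
  generalize s i = t, J i = X at *
  symm
  calc t * X * t * (t * X - X * t) = t * X * (t * t) * X - t * X * t * X * t := by noncomm_ring
    _ = t * X * (t * t) * X - X * t * X * (t * t) := by rw [comm]; noncomm_ring
    _ = (q - q⁻¹) • (t * X * t * X - X * t * X * t) + (t * X - X * t) * X := by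
      rw [sq]
      simp only [mul_add, add_mul, mul_one, mul_smul_comm, smul_mul_assoc, mul_assoc, sub_mul,
        smul_sub]
      abel
    _ = (t * X - X * t) * X := by rw [comm, sub_self, smul_zero, zero_add]

theorem inter_mul_J_succ (hS : IsJMSystem q v n s J) (hi : i + 1 < n) :
    inter s J i * J (i + 1) = J i * inter s J i := by
  have sq := hS.s_mul_self i hi
  have comm := hS.s_mul_J_mul_s_mul_J hi
  rw [hS.J_succ i hi, inter]
  generalize s i = t, J i = X at *
  calc (t * X - X * t) * (t * X * t) = t * X * t * X * t - X * (t * t) * X * t := by noncomm_ring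
    _ = X * t * X * (t * t) - X * (t * t) * X * t := by rw [comm]; noncomm_ring
    _ = X * (t * X - X * t) := by
      rw [sq]
      simp only [mul_add, add_mul, mul_one, mul_smul_comm, smul_mul_assoc, mul_assoc,
        mul_sub]
      abel

theorem commute_inter_J (hS : IsJMSystem q v n s J) {j : ℕ} (hi : i + 1 < n) (hj : j < n)
    (hji : j ≠ i) (hji' : j ≠ i + 1) : Commute (inter s J i) (J j) := by
  have hs := hS.commute_s_J i j hi hj hji hji'
  have hJ := hS.commute_J i j (Nat.lt_of_succ_lt hi) hj
  exact (hs.mul_left hJ).sub_left (hJ.mul_left hs)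

theorem inter_mul_self_expand (hS : IsJMSystem q v n s J) (hi : i + 1 < n) :
    inter s J i * inter s J i = 2 • (J i * s i * J i * s i) - s i * J i * J i * s i -
      (q - q⁻¹) • (J i * s i * J i) - J i * J i := by
  have sq := hS.s_mul_self i hi
  have comm := hS.s_mul_J_mul_s_mul_J hi
  rw [inter]
  generalize s i = t, J i = X at *
  calc (t * X - X * t) * (t * X - X * t)
      = t * X * t * X + X * t * X * t - t * X * X * t - X * (t * t) * X := by noncomm_ring
    _ = 2 • (X * t * X * t) - t * X * X * t - (q - q⁻¹) • (X * t * X) - X * X := by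
      rw [comm, sq]
      simp only [mul_add, add_mul, mul_one, mul_smul_comm, smul_mul_assoc]
      abel

theorem J_succ_mul_J_succ (hS : IsJMSystem q v n s J) (hi : i + 1 < n) :
    J (i + 1) * J (i + 1) = (q - q⁻¹) ^ 2 • (J i * s i * J i * s i) +
      (q - q⁻¹) • (J i * s i * J i) + s i * J i * J i * s i := by
  have sq := hS.s_mul_self i hi
  have comm := hS.s_mul_J_mul_s_mul_J hi
  rw [hS.J_succ i hi]
  generalize s i = t, J i = X at *
  calc t * X * t * (t * X * t) = t * X * (t * t) * X * t := by noncomm_ring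
    _ = (q - q⁻¹) • (t * X * t * X * t) + t * X * X * t := by
      rw [sq]
      simp only [mul_add, add_mul, mul_one, mul_smul_comm, smul_mul_assoc, mul_assoc]
    _ = (q - q⁻¹) • (X * t * X * (t * t)) + t * X * X * t := by rw [comm, mul_assoc _ t t]
    _ = (q - q⁻¹) ^ 2 • (X * t * X * t) + (q - q⁻¹) • (X * t * X) + t * X * X * t := by
      rw [sq]
      simp only [mul_add, mul_one, mul_smul_comm]
      module

theorem inter_mul_self (hS : IsJMSystem q v n s J) (hq : q ≠ 0) (hi : i + 1 < n) :
    inter s J i * inter s J i =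
      -((J (i + 1) - q ^ 2 • J i) * (J (i + 1) - (q ^ 2)⁻¹ • J i)) := by
  have J_succ_mul_J : J (i + 1) * J i = J i * s i * J i * s i := by
    rw [hS.J_succ i hi, hS.s_mul_J_mul_s_mul_J hi]
  have J_mul_J_succ : J i * J (i + 1) = J i * s i * J i * s i := by
    rw [hS.J_succ i hi, ← mul_assoc, ← mul_assoc]
  have expand : (J (i + 1) - q ^ 2 • J i) * (J (i + 1) - (q ^ 2)⁻¹ • J i) =
      J (i + 1) * J (i + 1) - (q ^ 2 + (q ^ 2)⁻¹) • (J i * s i * J i * s i) + J i * J i := by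
    simp only [sub_mul, mul_sub, mul_smul_comm, smul_mul_assoc, smul_sub, smul_smul,
      J_succ_mul_J, J_mul_J_succ]
    rw [inv_mul_cancel₀ (pow_ne_zero 2 hq)]
    module
  rw [hS.inter_mul_self_expand hi, expand, hS.J_succ_mul_J_succ hi]
  match_scalars <;> field_simp; ring

end IsJMSystem
end JMSystem

/-! ### Diagonalizable elements and joint eigenvectors -/

section Diagonalizable

variable {K A V : Type*} [Field K] [Ring A] [Algebra K A] [AddCommGroup V] [Module K V]
  [Module A V] [IsScalarTower K A V]

/-- An element of an algebra is diagonalizable if it is annihilated by a product of distinct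
linear factors; it then acts diagonalizably on every module. -/
def IsDiagonalizable (K : Type*) {A : Type*} [Field K] [Ring A] [Algebra K A] (T : A) : Prop :=
  ∃ S : Finset K, aeval T (∏ c ∈ S, (X - C c)) = 0

theorem aeval_X_sub_C_smul (T : A) (c : K) (x : V) : aeval T (X - C c) • x = T • x - c • x := by
  rw [map_sub, aeval_X, aeval_C, sub_smul, algebraMap_smul]

theorem smul_eq_iff_aeval_X_sub_C_smul {T : A} {c : K} {x : V} :
    T • x = c • x ↔ aeval T (X - C c) • x = 0 := by
  rw [aeval_X_sub_C_smul, sub_eq_zero]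

theorem aeval_smul_of_smul_eq {T : A} {c : K} {x : V} (hx : T • x = c • x) (p : K[X]) :
    aeval T p • x = p.eval c • x := by
  obtain ⟨r, hr⟩ := X_sub_C_dvd_sub_C_eval (p := p) (a := c)
  rw [sub_eq_iff_eq_add.1 hr, mul_comm, map_add, map_mul, add_smul, mul_smul,
    smul_eq_iff_aeval_X_sub_C_smul.1 hx, smul_zero, zero_add, aeval_C, algebraMap_smul, eval_add,
    eval_mul, eval_sub, eval_X, eval_C, sub_self, mul_zero, zero_add, eval_C]

omit [Module K V] [IsScalarTower K A V] in
theorem aeval_smul_comm (T : A) (p r : K[X]) (x : V) :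
    aeval T p • aeval T r • x = aeval T r • aeval T p • x := by
  rw [← mul_smul, ← mul_smul, ← map_mul, ← map_mul, mul_comm]

theorem aeval_smul_eq_zero_of_ne {T : A} {p : K[X]} {c d : K} {x : V}
    (hp : aeval T (X - C d) * aeval T p = 0) (hx : T • x = c • x) (hcd : c ≠ d) :
    aeval T p • x = 0 := by
  have h : (c - d) • aeval T p • x = 0 := by
    calc (c - d) • aeval T p • x = aeval T p • aeval T (X - C d) • x := by
          rw [aeval_X_sub_C_smul, hx, ← sub_smul, smul_comm]
      _ = 0 := by rw [aeval_smul_comm, ← mul_smul, hp, zero_smul]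
  exact (smul_eq_zero.1 h).resolve_left (sub_ne_zero.2 hcd)

theorem exists_eq_of_aeval_prod_X_sub_C_eq_zero {ι : Type*} {S : Finset ι} {f : ι → K} {T : A}
    {c : K} {x : V} (hT : aeval T (∏ i ∈ S, (X - C (f i))) = 0) (hx : x ≠ 0)
    (hc : T • x = c • x) : ∃ i ∈ S, c = f i := by
  have h := aeval_smul_of_smul_eq hc (∏ i ∈ S, (X - C (f i)))
  rw [hT, zero_smul, eq_comm, smul_eq_zero, or_iff_left hx, eval_prod,
    Finset.prod_eq_zero_iff] at h
  simpa only [eval_sub, eval_X, eval_C, sub_eq_zero] using h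

theorem prod_X_sub_C_dvd_X_sub_C_mul_basis [DecidableEq K] (S : Finset K) (c : K) :
    ∏ b ∈ S, (X - C b) ∣ (X - C c) * Lagrange.basis S id c := by
  have erase_dvd : ∏ b ∈ S.erase c, (X - C b) ∣ Lagrange.basis S id c :=
    Finset.prod_dvd_prod_of_dvd _ _ fun b _ => Dvd.intro_left _ rfl
  by_cases hc : c ∈ S
  · rw [← Finset.mul_prod_erase S _ hc]
    exact mul_dvd_mul_left _ erase_dvd
  · rw [Finset.erase_eq_of_notMem hc] at erase_dvd
    exact erase_dvd.mul_left _

theorem eval_basis_id [DecidableEq K] (S : Finset K) (c : K) :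
    (Lagrange.basis S id c).eval c = 1 := by
  rw [Lagrange.basis, eval_prod]
  exact Finset.prod_eq_one fun b hb =>
    Lagrange.eval_basisDivisor_left_of_ne (Finset.ne_of_mem_erase hb).symm

namespace IsDiagonalizable

variable {T : A}

theorem exists_projections (hT : IsDiagonalizable K T) :
    ∃ p : K → K[X], (∀ c, aeval T (X - C c) * aeval T (p c) = 0) ∧ (∀ c, (p c).eval c = 1) ∧
      ∃ S : Finset K, ∑ c ∈ S, aeval T (p c) = 1 := by
  classical
  obtain ⟨S, hS⟩ := hT
  refine ⟨Lagrange.basis S id, fun c => ?_, eval_basis_id S, S, ?_⟩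
  · obtain ⟨r, hr⟩ := prod_X_sub_C_dvd_X_sub_C_mul_basis S c
    rw [← map_mul, hr, map_mul, hS, zero_mul]
  · rcases S.eq_empty_or_nonempty with rfl | hne
    · simpa using hS.symm
    · rw [← map_sum, Lagrange.sum_basis Function.injective_id.injOn hne, map_one]

theorem mem_span_eigenvectors (hT : IsDiagonalizable K T) (y : V) :
    y ∈ Submodule.span K {z | (∃ p : K[X], z = aeval T p • y) ∧ ∃ c : K, T • z = c • z} := by
  obtain ⟨p, hp, -, S, hsum⟩ := hT.exists_projections
  have hy : y = ∑ c ∈ S, aeval T (p c) • y := by rw [← Finset.sum_smul, hsum, one_smul]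
  rw [hy]
  refine Submodule.sum_mem _ fun c _ => Submodule.subset_span ⟨⟨p c, ?_⟩, c, ?_⟩
  · rw [← hy]
  · rw [smul_eq_iff_aeval_X_sub_C_smul, ← mul_smul, hp, zero_smul]

theorem aeval_X_sub_C_smul_eq_zero (hT : IsDiagonalizable K T) {c : K} {z : V}
    (hz : aeval T (X - C c) • aeval T (X - C c) • z = 0) : aeval T (X - C c) • z = 0 := by
  obtain ⟨p, hp, hp_eval, -⟩ := hT.exists_projections
  calc aeval T (X - C c) • z = (p c).eval c • aeval T (X - C c) • z := by
        rw [hp_eval, one_smul]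
    _ = aeval T (p c) • aeval T (X - C c) • z :=
        (aeval_smul_of_smul_eq (smul_eq_iff_aeval_X_sub_C_smul.2 hz) _).symm
    _ = 0 := by rw [aeval_smul_comm, ← mul_smul, hp, zero_smul]

end IsDiagonalizable

omit [Module K V] [IsScalarTower K A V] in
theorem aeval_prod_X_sub_C_smul_eq_zero {T : A} {M : Set V}
    (stable : ∀ w ∈ M, ∀ p : K[X], aeval T p • w ∈ M)
    (reduced : ∀ w ∈ M, ∀ c : K, aeval T (X - C c) • aeval T (X - C c) • w = 0 →
      aeval T (X - C c) • w = 0)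
    (S : Finset K) {w : V} (hw : w ∈ M)
    (h : aeval T (∏ c ∈ S, (X - C c)) • aeval T (∏ c ∈ S, (X - C c)) • w = 0) :
    aeval T (∏ c ∈ S, (X - C c)) • w = 0 := by
  classical
  induction S using Finset.induction_on generalizing w with
  | empty => simpa using h
  | insert c S hc ih =>
    simp only [Finset.prod_insert hc, map_mul, mul_smul] at h ⊢
    rw [aeval_smul_comm]
    refine ih (stable w hw _) ?_
    rw [aeval_smul_comm _ _ (X - C c), aeval_smul_comm _ _ (X - C c)]
    refine reduced _ (stable _ (stable w hw _) _) c ?_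
    rwa [aeval_smul_comm _ _ (X - C c)] at h

end Diagonalizable

section JointEigenvector

variable {K A V : Type*} [Field K] [Ring A] [Algebra K A] [AddCommGroup V] [Module K V]
  [Module A V]

/-- `x` is a (possibly zero) common eigenvector of `J 0, …, J (k - 1)` with eigenvalues
`a 0, …, a (k - 1)`. -/
def IsJointEigenvector (J : ℕ → A) (k : ℕ) (a : ℕ → K) (x : V) : Prop :=
  ∀ i < k, J i • x = a i • x

/-- The subalgebra `K[J 0, …, J (k - 1)]`. -/
def jmAlgebra (K : Type*) {A : Type*} [Field K] [Ring A] [Algebra K A] (J : ℕ → A) (k : ℕ) :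
    Subalgebra K A :=
  Algebra.adjoin K (J '' Set.Iio k)

variable {J : ℕ → A} {k l : ℕ} {a : ℕ → K} {x : V}

theorem mem_jmAlgebra {i : ℕ} (hi : i < k) : J i ∈ jmAlgebra K J k :=
  Algebra.subset_adjoin ⟨i, hi, rfl⟩

theorem jmAlgebra_mono (hkl : k ≤ l) : jmAlgebra K J k ≤ jmAlgebra K J l :=
  Algebra.adjoin_mono (Set.image_mono (Set.Iio_subset_Iio hkl))

theorem aeval_mem_jmAlgebra {i : ℕ} (hi : i < k) (p : K[X]) :
    aeval (J i) p ∈ jmAlgebra K J k :=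
  Algebra.adjoin_singleton_le (mem_jmAlgebra hi) (aeval_mem_adjoin_singleton K (J i))

theorem commute_of_mem_jmAlgebra {z r : A} (hz : ∀ i < k, Commute z (J i))
    (hr : r ∈ jmAlgebra K J k) : Commute z r := by
  refine Algebra.commute_of_mem_adjoin_of_forall_mem_commute hr ?_
  rintro _ ⟨i, hi, rfl⟩
  exact hz i hi

namespace IsJointEigenvector

omit [Algebra K A] in
theorem mono (hx : IsJointEigenvector J l a x) (hkl : k ≤ l) : IsJointEigenvector J k a x :=
  fun i hi => hx i (hi.trans_le hkl)

omit [Algebra K A] in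
theorem succ (hx : IsJointEigenvector J k a x) {c : K} (hc : J k • x = c • x) :
    IsJointEigenvector J (k + 1) (Function.update a k c) x := by
  intro i hi
  rcases (Nat.le_of_lt_succ hi).lt_or_eq with h | rfl
  · rw [hx i h, Function.update_of_ne h.ne]
  · rw [hc, Function.update_self]

variable [IsScalarTower K A V]

theorem smul_of_commute (hx : IsJointEigenvector J k a x) {r : A}
    (hr : ∀ i < k, Commute r (J i)) : IsJointEigenvector J k a (r • x) := by
  intro i hi
  rw [← mul_smul, ← (hr i hi).eq, mul_smul, hx i hi, smul_comm]

end IsJointEigenvector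

variable [IsScalarTower K A V]

/-- The vectors that are obtained from `y` by polynomials in `J 0, …, J (k - 1)` and are common
eigenvectors of these elements. -/
def jointComponents (K : Type*) {A V : Type*} [Field K] [Ring A] [Algebra K A] [AddCommGroup V]
    [Module K V] [Module A V] (J : ℕ → A) (k : ℕ) (y : V) : Set V :=
  {z | (∃ r ∈ jmAlgebra K J k, z = r • y) ∧ ∃ a : ℕ → K, IsJointEigenvector J k a z}

theorem mem_span_jointComponents (diag : ∀ i < k, IsDiagonalizable K (J i))
    (comm : ∀ i < k, ∀ j < k, Commute (J i) (J j)) (y : V) :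
    y ∈ Submodule.span K (jointComponents K J k y) := by
  induction k with
  | zero =>
    refine Submodule.subset_span ⟨⟨1, one_mem _, (one_smul A y).symm⟩, 0, ?_⟩
    exact fun i hi => absurd hi i.not_lt_zero
  | succ k ih =>
    refine Submodule.span_le.2 ?_ (ih (fun i hi => diag i (hi.trans k.lt_succ_self))
      fun i hi j hj => comm i (hi.trans k.lt_succ_self) j (hj.trans k.lt_succ_self))
    rintro z ⟨⟨r, hr, rfl⟩, a, ha⟩
    refine Submodule.span_mono ?_ ((diag k k.lt_succ_self).mem_span_eigenvectors (r • y))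
    rintro _ ⟨⟨p, rfl⟩, c, hc⟩
    have hp : aeval (J k) p ∈ jmAlgebra K J (k + 1) :=
      aeval_mem_jmAlgebra k.lt_succ_self p
    refine ⟨⟨aeval (J k) p * r, mul_mem hp (jmAlgebra_mono k.le_succ hr), (mul_smul _ _ _).symm⟩,
      _, IsJointEigenvector.succ (ha.smul_of_commute fun i hi => ?_) hc⟩
    exact (commute_of_mem_jmAlgebra (fun j hj => comm i (hi.trans k.lt_succ_self) j hj) hp).symm

end JointEigenvector

/-! ### Content strings -/

section ContentStrings

variable {K : Type*} [Field K] {m : ℕ}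

/-- The conditions on parameters `Q` and `v₁, …, vₘ` under which the contents `vⱼ Qⁱ` tell apart
the nodes of multipartitions of size at most `n`. -/
structure SeparatedParameters (Q : K) (v : Fin m → K) (n : ℕ) : Prop where
  Q_ne_zero : Q ≠ 0
  v_ne_zero : ∀ j, v j ≠ 0
  pow_ne_one : 2 ≤ n → ∀ i, 1 ≤ i → i ≤ n → Q ^ i ≠ 1
  mul_pow_ne : ∀ i, i < n → ∀ j k, j ≠ k → v j * Q ^ i ≠ v k

/-- `c` and `d` are different and not neighbours in a string of contents. -/
def Separated (Q c d : K) : Prop := c ≠ d ∧ c ≠ Q * d ∧ d ≠ Q * c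

/-- `c` may be appended to the string `a 0, …, a (k - 1)`, that is, the content `c` belongs to an
addable node: it is some `vⱼ` or a neighbour of an entry, and after each entry `c` both neighbouring
contents occur. -/
def Appendable (Q : K) (v : Fin m → K) (k : ℕ) (a : ℕ → K) (c : K) : Prop :=
  ((∃ j, c = v j) ∨ ∃ p < k, a p = Q * c ∨ c = Q * a p) ∧
    ∀ i < k, a i = c →
      (∃ p, i < p ∧ p < k ∧ a p = Q * c) ∧ ∃ p, i < p ∧ p < k ∧ c = Q * a p

/-- The first `k` terms of `a` are the contents of a standard multitableau, read in the order of
its entries. -/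
def IsContentString (Q : K) (v : Fin m → K) (k : ℕ) (a : ℕ → K) : Prop :=
  ∀ i < k, Appendable Q v i a (a i)

variable {Q : K} {v : Fin m → K} {n k l : ℕ} {a b : ℕ → K} {c d : K}

namespace SeparatedParameters

theorem mono (hP : SeparatedParameters Q v n) (hk : k ≤ n) : SeparatedParameters Q v k where
  Q_ne_zero := hP.Q_ne_zero
  v_ne_zero := hP.v_ne_zero
  pow_ne_one h2 i h1 hi := hP.pow_ne_one (h2.trans hk) i h1 (hi.trans hk)
  mul_pow_ne i hi := hP.mul_pow_ne i (hi.trans_le hk)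

theorem v_injective (hP : SeparatedParameters Q v n) (hn : 0 < n) : Function.Injective v :=
  fun j k h => by_contra fun hjk => hP.mul_pow_ne 0 hn j k hjk (by rw [pow_zero, mul_one, h])

theorem pow_injOn (hP : SeparatedParameters Q v n) (hn : 2 ≤ n) :
    Set.InjOn (Q ^ · : ℕ → K) (Set.Iic n) := by
  have ne_of_lt : ∀ x ∈ Set.Iic n, ∀ y ∈ Set.Iic n, x < y → Q ^ x ≠ Q ^ y := by
    intro x _ y hy hxy h
    refine hP.pow_ne_one hn (y - x) (by omega) ((y.sub_le x).trans hy)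
      (mul_left_cancel₀ (pow_ne_zero x hP.Q_ne_zero) ?_)
    rw [← pow_add, mul_one, h, Nat.add_sub_cancel' hxy.le]
  intro x hx y hy h
  by_contra hxy
  rcases lt_or_gt_of_ne hxy with hlt | hlt
  · exact ne_of_lt x hx y hy hlt h
  · exact ne_of_lt y hy x hx hlt h.symm

theorem Q_ne_one (hP : SeparatedParameters Q v n) (hn : 2 ≤ n) : Q ≠ 1 := fun h =>
  hP.pow_ne_one hn 1 le_rfl (one_le_two.trans hn) (by rw [h, one_pow])

theorem Q_ne_neg_one (hP : SeparatedParameters Q v n) (hn : 2 ≤ n) : Q ≠ -1 := fun h =>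
  hP.pow_ne_one hn 2 one_le_two hn (by rw [h, neg_one_sq])

theorem mul_ne_inv_mul (hP : SeparatedParameters Q v n) (hn : 2 ≤ n) (hc : c ≠ 0) :
    Q * c ≠ Q⁻¹ * c := by
  intro h
  refine hP.pow_ne_one hn 2 one_le_two hn ?_
  rw [sq]
  nth_rw 1 [mul_right_cancel₀ hc h]
  exact inv_mul_cancel₀ hP.Q_ne_zero

end SeparatedParameters

theorem Appendable.congr (h : Appendable Q v k a c) (hab : ∀ i < k, a i = b i) :
    Appendable Q v k b c := by
  refine ⟨h.1.imp id fun ⟨p, hp, hpc⟩ => ⟨p, hp, by rwa [← hab p hp]⟩, fun i hi hic => ?_⟩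
  obtain ⟨⟨p, hip, hpk, hpc⟩, r, hir, hrk, hrc⟩ := h.2 i hi (by rw [hab i hi, hic])
  exact ⟨⟨p, hip, hpk, by rwa [← hab p hpk]⟩, r, hir, hrk, by rwa [← hab r hrk]⟩

theorem IsContentString.mono (h : IsContentString Q v k a) (hlk : l ≤ k) :
    IsContentString Q v l a :=
  fun i hi => h i (hi.trans_le hlk)

/-- The node of content `c` is reached from the diagonal of its component along a row or column. -/
theorem Appendable.exists_run (hQ : Q ≠ 0) (ha : IsContentString Q v k a)
    (hc : Appendable Q v k a c) :
    ∃ (j : Fin m) (z : ℤ), c = v j * Q ^ z ∧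
      ∀ t ∈ Set.uIcc 0 z, t ≠ z → ∃ p < k, a p = v j * Q ^ t := by
  induction k using Nat.strong_induction_on generalizing c with
  | _ k ih =>
  have extend : ∀ p < k, ∀ e : ℤ, e = 1 ∨ e = -1 → c = a p * Q ^ e →
      ∃ (j : Fin m) (z : ℤ), c = v j * Q ^ z ∧
        ∀ t ∈ Set.uIcc 0 z, t ≠ z → ∃ p < k, a p = v j * Q ^ t := by
    intro p hp e he hce
    obtain ⟨j, z, hz, run⟩ := ih p hp (ha.mono hp.le) (ha p hp)
    refine ⟨j, z + e, by rw [hce, hz, zpow_add₀ hQ, mul_assoc], fun t ht htz => ?_⟩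
    rcases eq_or_ne t z with rfl | hne
    · exact ⟨p, hp, hz⟩
    · have ht' : t ∈ Set.uIcc 0 z := by
        rw [Set.mem_uIcc] at ht ⊢
        omega
      obtain ⟨r, hr, har⟩ := run t ht' hne
      exact ⟨r, hr.trans hp, har⟩
  rcases hc.1 with ⟨j, rfl⟩ | ⟨p, hp, h | h⟩
  · refine ⟨j, 0, by rw [zpow_zero, mul_one], fun t ht ht0 => absurd ?_ ht0⟩
    simpa using ht
  · refine extend p hp (-1) (Or.inr rfl) ?_
    rw [h, zpow_neg_one, mul_comm Q, mul_inv_cancel_right₀ hQ]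
  · exact extend p hp 1 (Or.inl rfl) (by rw [h, zpow_one, mul_comm])

theorem Appendable.ne_and_ne_mul (hQ : Q ≠ 0) (hc : Appendable Q v k a c)
    (hQc : Appendable Q v k a (Q * c)) {i : ℕ} (hi : i < k) : a i ≠ c ∧ a i ≠ Q * c := by
  induction h : k - i using Nat.strong_induction_on generalizing i with
  | _ e ih =>
  refine ⟨fun hic => ?_, fun hic => ?_⟩
  · obtain ⟨⟨p, hip, hpk, hp⟩, -⟩ := hc.2 i hi hic
    exact (ih (k - p) (by omega) hpk rfl).2 hp
  · obtain ⟨-, p, hip, hpk, hp⟩ := hQc.2 i hi hic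
    exact (ih (k - p) (by omega) hpk rfl).1 (mul_left_cancel₀ hQ hp).symm

theorem card_le_of_pow_occurs {S : Finset ℕ} (hd : d ≠ 0) (inj : Set.InjOn (Q ^ · : ℕ → K) S)
    (occurs : ∀ u ∈ S, ∃ p < k, a p = d * Q ^ u) : S.card ≤ k := by
  choose! f hfk hf using occurs
  rw [← Finset.card_range k]
  refine Finset.card_le_card_of_injOn f (fun u hu => by simpa using hfk u hu) fun u hu w hw h => ?_
  exact inj hu hw (mul_left_cancel₀ hd (by rw [← hf u hu, ← hf w hw, h]))

theorem exists_run_through (hQ : Q ≠ 0) (ha : IsContentString Q v k a)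
    (hc : Appendable Q v k a c) (hQc : Appendable Q v k a (Q * c)) :
    ∃ (j j' : Fin m) (L N : ℕ), L < N ∧ v j * Q ^ N = v j' ∧
      ∀ u ≤ N, u ≠ L → u ≠ L + 1 → ∃ p < k, a p = v j * Q ^ u := by
  have hne : ∀ i < k, a i ≠ c ∧ a i ≠ Q * c := fun i hi => hc.ne_and_ne_mul hQ hQc hi
  obtain ⟨j, z, hz, run⟩ := hc.exists_run hQ ha
  obtain ⟨j', z', hz', run'⟩ := hQc.exists_run hQ ha
  have z_nonneg : 0 ≤ z := by
    by_contra! hlt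
    obtain ⟨p, hp, hap⟩ := run (z + 1) (by rw [Set.mem_uIcc]; omega) (by omega)
    exact (hne p hp).2 (by rw [hap, hz, zpow_add_one₀ hQ]; ring)
  have z'_nonpos : z' ≤ 0 := by
    by_contra! hlt
    obtain ⟨p, hp, hap⟩ := run' (z' - 1) (by rw [Set.mem_uIcc]; omega) (by omega)
    exact (hne p hp).1 (by rw [hap, zpow_sub_one₀ hQ, ← mul_assoc, ← hz']; field_simp)
  obtain ⟨L, rfl⟩ := Int.eq_ofNat_of_zero_le z_nonneg
  obtain ⟨L', hL'⟩ := Int.eq_ofNat_of_zero_le (neg_nonneg.2 z'_nonpos)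
  have connect : ∀ t : ℤ, v j' * Q ^ t = v j * Q ^ (L + L' + 1 + t) := by
    intro t
    have hvj' : v j' = Q * c * Q ^ (L' : ℤ) := by
      rw [hz', ← hL', mul_assoc, ← zpow_add₀ hQ, add_neg_cancel, zpow_zero, mul_one]
    rw [hvj', hz, zpow_add₀ hQ, zpow_add₀ hQ, zpow_add₀ hQ, zpow_one]
    ring
  refine ⟨j, j', L, L + L' + 1, by omega, ?_, fun u hu hu1 hu2 => ?_⟩
  · exact_mod_cast (by simpa using (connect 0).symm : v j * Q ^ (L + L' + 1 : ℤ) = v j')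
  · rcases Nat.lt_or_ge u L with hlt | hge
    · simpa using run u (by rw [Set.mem_uIcc]; omega) (by omega)
    · have h := run' (u - (L + L' + 1)) (by rw [Set.mem_uIcc]; omega) (by omega)
      simpa [connect] using h

/-- The runs to the nodes of contents `c` and `Q c` together connect two of the `vⱼ`. The parameters
being separated, this needs more than `k` nodes. -/
theorem not_appendable_and_appendable_mul (hP : SeparatedParameters Q v n) (hk : k + 2 ≤ n)
    (ha : IsContentString Q v k a) (hc : Appendable Q v k a c)
    (hQc : Appendable Q v k a (Q * c)) : False := by
  have hn : 2 ≤ n := by omega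
  obtain ⟨j, j', L, N, hLN, hN, occurs⟩ := exists_run_through hP.Q_ne_zero ha hc hQc
  have N_lt : N < n := by
    by_contra! hnN
    have card_le : (Finset.range (n + 1) \ {L, L + 1}).card ≤ k := by
      refine card_le_of_pow_occurs (a := a) (hP.v_ne_zero j)
        ((hP.pow_injOn hn).mono fun u hu => ?_) fun u hu => ?_
      · exact Nat.lt_succ_iff.1 (Finset.mem_range.1 (Finset.mem_sdiff.1 hu).1)
      · simp only [Finset.mem_sdiff, Finset.mem_range, Finset.mem_insert,
          Finset.mem_singleton] at hu
        exact occurs u (by omega) (by omega) (by omega)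
    have le_card := Finset.le_card_sdiff {L, L + 1} (Finset.range (n + 1))
    have card_pair_le := Finset.card_le_two (a := L) (b := L + 1)
    rw [Finset.card_range] at le_card
    omega
  rcases eq_or_ne j j' with rfl | hj
  · exact hP.pow_ne_one hn N (by omega) N_lt.le
      (mul_left_cancel₀ (hP.v_ne_zero j) (by rw [hN, mul_one]))
  · exact hP.mul_pow_ne N N_lt j j' hj hN

theorem IsContentString.not_neighbours (hP : SeparatedParameters Q v n) (hk : k + 2 ≤ n)
    (ha : IsContentString Q v (k + 1) a) (hb : IsContentString Q v (k + 1) b)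
    (hab : ∀ i < k, a i = b i) : ¬ (a k = Q * b k ∨ b k = Q * a k) := by
  have hak := (ha k k.lt_succ_self).congr hab
  have hbk := hb k k.lt_succ_self
  rintro (h | h)
  · exact not_appendable_and_appendable_mul hP hk (hb.mono k.le_succ) hbk (h ▸ hak)
  · exact not_appendable_and_appendable_mul hP hk (hb.mono k.le_succ) hak (h ▸ hbk)

end ContentStrings

section Sequences

variable {α : Type*} {a : ℕ → α} {i k : ℕ}

theorem swap_succ_of_ne {i j : ℕ} (h : j ≠ i) (h' : j ≠ i + 1) :
    (a ∘ Equiv.swap i (i + 1)) j = a j := by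
  rw [Function.comp_apply, Equiv.swap_apply_of_ne_of_ne h h']

theorem swap_succ_left : (a ∘ Equiv.swap i (i + 1)) i = a (i + 1) := by
  rw [Function.comp_apply, Equiv.swap_apply_left]

theorem swap_succ_right : (a ∘ Equiv.swap i (i + 1)) (i + 1) = a i := by
  rw [Function.comp_apply, Equiv.swap_apply_right]

theorem exists_last_occurrence (hi : i < k) (hik : a i = a k) :
    ∃ p, i ≤ p ∧ p < k ∧ a p = a k ∧ ∀ u, p < u → u < k → a u ≠ a k := by
  classical
  have hle : i ≤ k - 1 := Nat.le_sub_one_of_lt hi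
  refine ⟨Nat.findGreatest (fun p => a p = a k) (k - 1), Nat.le_findGreatest hle hik,
    (Nat.findGreatest_le _).trans_lt (by omega),
    Nat.findGreatest_spec (P := fun p => a p = a k) hle hik, fun u hpu hu => ?_⟩
  exact Nat.findGreatest_is_greatest hpu (Nat.le_sub_one_of_lt hu)

end Sequences

section ThinReturn

variable {K : Type*} [Field K] {m : ℕ} {Q t c d : K} {v : Fin m → K} {a : ℕ → K} {k i p r w : ℕ}

theorem separated_or_eq_mul (hQ : Q ≠ 0) (ht : t = Q ∨ t = Q⁻¹) (hdc : d ≠ c) (hd : d ≠ t * c) :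
    Separated Q d c ∨ c = t * d := by
  refine or_iff_not_imp_right.2 fun hc => ⟨hdc, ?_⟩
  rcases ht with rfl | rfl
  · exact ⟨hd, hc⟩
  · exact ⟨fun h => hc (by rw [h, inv_mul_cancel_left₀ hQ]),
      fun h => hd (by rw [h, inv_mul_cancel_left₀ hQ])⟩

theorem Appendable.exists_eq_mul (hQ : Q ≠ 0) (ht : t = Q ∨ t = Q⁻¹) (hc : Appendable Q v k a c)
    (hi : i < k) (hic : a i = c) : ∃ p, i < p ∧ p < k ∧ a p = t * c := by
  obtain ⟨above, p, hip, hpk, hp⟩ := hc.2 i hi hic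
  rcases ht with rfl | rfl
  · exact above
  · exact ⟨p, hip, hpk, by rw [hp, inv_mul_cancel_left₀ hQ]⟩

/-- The string `a` has the same entry at `p` and at `r`, and between these places neither this
entry nor its multiple by `t` occurs, and its multiple by `t⁻¹` occurs at most once. With
`t = Q` or `t = Q⁻¹`, no string of eigenvalues of Jucys–Murphy elements has this form. -/
structure IsThinReturn (t : K) (a : ℕ → K) (p r : ℕ) : Prop where
  lt : p < r
  eq : a p = a r
  ne : ∀ u, p < u → u < r → a u ≠ a r
  ne_mul : ∀ u, p < u → u < r → a u ≠ t * a r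
  subsingleton : {u | p < u ∧ u < r ∧ a r = t * a u}.Subsingleton

namespace IsThinReturn

theorem shrink_right (h : IsThinReturn t a p (w + 1)) (hpw : p < w) :
    IsThinReturn t (a ∘ Equiv.swap w (w + 1)) p w := by
  have agree : ∀ u < w, (a ∘ Equiv.swap w (w + 1)) u = a u := fun u hu =>
    swap_succ_of_ne hu.ne (hu.trans w.lt_succ_self).ne
  refine ⟨hpw, ?_, fun u hpu hu => ?_, fun u hpu hu => ?_, ?_⟩
  · rw [agree p hpw, swap_succ_left, h.eq]
  · rw [agree u hu, swap_succ_left]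
    exact h.ne u hpu (hu.trans w.lt_succ_self)
  · rw [agree u hu, swap_succ_left]
    exact h.ne_mul u hpu (hu.trans w.lt_succ_self)
  · rintro u ⟨hpu, hu, hau⟩ u' ⟨hpu', hu', hau'⟩
    rw [agree u hu, swap_succ_left] at hau
    rw [agree u' hu', swap_succ_left] at hau'
    exact h.subsingleton ⟨hpu, hu.trans w.lt_succ_self, hau⟩
      ⟨hpu', hu'.trans w.lt_succ_self, hau'⟩

theorem shrink_left (h : IsThinReturn t a p r) (hpr : p + 1 < r) :
    IsThinReturn t (a ∘ Equiv.swap p (p + 1)) (p + 1) r := by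
  have agree : ∀ u, p + 1 < u → (a ∘ Equiv.swap p (p + 1)) u = a u := fun u hu =>
    swap_succ_of_ne (p.lt_succ_self.trans hu).ne' hu.ne'
  refine ⟨hpr, ?_, fun u hpu hu => ?_, fun u hpu hu => ?_, ?_⟩
  · rw [agree r hpr, swap_succ_right, h.eq]
  · rw [agree u hpu, agree r hpr]
    exact h.ne u (p.lt_succ_self.trans hpu) hu
  · rw [agree u hpu, agree r hpr]
    exact h.ne_mul u (p.lt_succ_self.trans hpu) hu
  · rintro u ⟨hpu, hu, hau⟩ u' ⟨hpu', hu', hau'⟩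
    rw [agree u hpu, agree r hpr] at hau
    rw [agree u' hpu', agree r hpr] at hau'
    exact h.subsingleton ⟨p.lt_succ_self.trans hpu, hu, hau⟩
      ⟨p.lt_succ_self.trans hpu', hu', hau'⟩

end IsThinReturn

theorem IsContentString.exists_isThinReturn (hQ : Q ≠ 0) (ht : t = Q ∨ t = Q⁻¹)
    (ha : IsContentString Q v k a) (hi : i < k) (hik : a i = a k)
    (hne : ∀ p, i < p → p < k → a p ≠ t * a k) : ∃ p, IsThinReturn t a p k := by
  have ht0 : t ≠ 0 := by
    rcases ht with rfl | rfl
    exacts [hQ, inv_ne_zero hQ]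
  obtain ⟨p, hip, hpk, hap, last⟩ := exists_last_occurrence hi hik
  have not_lt_of_eq : ∀ u u', p < u → u' < k → a k = t * a u → a k = t * a u' → ¬ u < u' := by
    intro u u' hpu hu' hau hau' hlt
    obtain ⟨w, huw, hwu', hw⟩ := (ha u' hu').exists_eq_mul hQ ht hlt
      (mul_left_cancel₀ ht0 (hau.symm.trans hau'))
    exact last w (hpu.trans huw) (hwu'.trans hu') (hw.trans hau'.symm)
  refine ⟨p, hpk, hap, last, fun u hpu => hne u (hip.trans_lt hpu), ?_⟩
  rintro u ⟨hpu, hu, hau⟩ u' ⟨hpu', hu', hau'⟩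
  exact le_antisymm (Nat.not_lt.1 (not_lt_of_eq u' u hpu' hu hau' hau))
    (Nat.not_lt.1 (not_lt_of_eq u u' hpu hu' hau hau'))

end ThinReturn

/-! ### Joint eigenvalues of Jucys–Murphy elements -/

section Spectrum

variable {K A V : Type*} [Field K] [Ring A] [Algebra K A] [AddCommGroup V] [Module K V]
  [Module A V] [IsScalarTower K A V]
  {m n k : ℕ} {q : K} {v : Fin m → K} {s J : ℕ → A} {a : ℕ → K} {x : V} {i : ℕ} {c d : K}

theorem SeparatedParameters.q_ne_zero (hP : SeparatedParameters (q ^ 2) v n) : q ≠ 0 :=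
  fun h => hP.Q_ne_zero (by rw [h, zero_pow two_ne_zero])

theorem SeparatedParameters.sub_inv_ne_zero (hP : SeparatedParameters (q ^ 2) v n) (hn : 2 ≤ n) :
    q - q⁻¹ ≠ 0 := by
  intro h
  refine hP.Q_ne_one hn ?_
  rw [sq, ← mul_inv_cancel₀ hP.q_ne_zero, ← sub_eq_zero.1 h]

theorem prod_X_sub_C_mul_dvd_mul_self {S T : Finset K} (hST : S ⊆ T) (hc : c ∈ T) (hd : d ∈ T)
    (hcd : c ≠ d) :
    (∏ b ∈ S, (X - C b)) * ((X - C c) * (X - C d)) ∣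
      (∏ b ∈ T, (X - C b)) * ∏ b ∈ T, (X - C b) := by
  classical
  rw [← Finset.prod_pair (f := fun b => X - C b) hcd]
  exact mul_dvd_mul (Finset.prod_dvd_prod_of_subset _ _ _ hST)
    (Finset.prod_dvd_prod_of_subset _ _ _
      (Finset.insert_subset hc (Finset.singleton_subset_iff.2 hd)))

namespace IsJMSystem

theorem inter_smul (hS : IsJMSystem q v n s J) (hi : i + 1 < n) (hc : J i • x = c • x)
    (hd : J (i + 1) • x = d • x) :
    inter s J i • x = (c - d) • s i • x + ((q - q⁻¹) * d) • x := by
  rw [inter, hS.J_mul_s hi, sub_smul, sub_smul, mul_smul, mul_smul, smul_assoc, hc, hd,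
    smul_comm _ c, smul_comm _ d, smul_smul, sub_smul]
  abel

theorem inter_mul_aeval (hS : IsJMSystem q v n s J) (hi : i + 1 < n) (p : K[X]) :
    inter s J i * aeval (J i) p = aeval (J (i + 1)) p * inter s J i := by
  induction p using Polynomial.induction_on' with
  | add p r hp hr => rw [map_add, map_add, mul_add, add_mul, hp, hr]
  | monomial e r =>
    have hpow : inter s J i * J i ^ e = J (i + 1) ^ e * inter s J i :=
      SemiconjBy.pow_right (hS.inter_mul_J hi) e
    rw [aeval_monomial, aeval_monomial, ← mul_assoc, ← Algebra.commutes, mul_assoc, hpow,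
      mul_assoc]

theorem inter_mul_aeval_succ (hS : IsJMSystem q v n s J) (hi : i + 1 < n) (p : K[X]) :
    inter s J i * aeval (J (i + 1)) p = aeval (J i) p * inter s J i := by
  induction p using Polynomial.induction_on' with
  | add p r hp hr => rw [map_add, map_add, mul_add, add_mul, hp, hr]
  | monomial e r =>
    have hpow : inter s J i * J (i + 1) ^ e = J i ^ e * inter s J i :=
      SemiconjBy.pow_right (hS.inter_mul_J_succ hi) e
    rw [aeval_monomial, aeval_monomial, ← mul_assoc, ← Algebra.commutes, mul_assoc, hpow,
      mul_assoc]

theorem inter_inter_smul (hS : IsJMSystem q v n s J) (hq : q ≠ 0) (hi : i + 1 < n)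
    (hc : J i • x = c • x) :
    inter s J i • inter s J i • x = -(aeval (J (i + 1)) (X - C (q ^ 2 * c)) •
      aeval (J (i + 1)) (X - C ((q ^ 2)⁻¹ * c)) • x) := by
  have replace : ∀ (z : V) (r : K), J i • z = c • z →
      (J (i + 1) - r • J i) • z = aeval (J (i + 1)) (X - C (r * c)) • z := by
    intro z r hz
    rw [aeval_X_sub_C_smul, sub_smul, smul_assoc, hz, smul_smul]
  rw [← mul_smul, hS.inter_mul_self hq hi, neg_smul, mul_smul, replace x _ hc, replace]
  rw [← mul_smul, (commute_of_mem_jmAlgebra (fun j hj => hS.commute_J i j (by omega) hj)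
    (aeval_mem_jmAlgebra hi _)).eq, mul_smul, hc, smul_comm]

theorem inter_smul_ne_zero (hS : IsJMSystem q v n s J) (hq : q ≠ 0) (hi : i + 1 < n) (hx : x ≠ 0)
    (hc : J i • x = c • x) (hd : J (i + 1) • x = d • x) (hcd : c ≠ q ^ 2 * d)
    (hdc : d ≠ q ^ 2 * c) : inter s J i • x ≠ 0 := by
  intro h
  have hsq := hS.inter_inter_smul hq hi hc
  rw [h, smul_zero, aeval_smul_of_smul_eq hd, smul_comm, aeval_smul_of_smul_eq hd, eq_comm,
    neg_eq_zero] at hsq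
  simp only [eval_sub, eval_X, eval_C, smul_eq_zero, sub_eq_zero, hx, or_false] at hsq
  rcases hsq with h | h
  · exact hcd (by rw [h, mul_inv_cancel_left₀ (pow_ne_zero 2 hq)])
  · exact hdc h

theorem isJointEigenvector_inter_smul (hS : IsJMSystem q v n s J) (hk : k ≤ n) (hi : i + 1 < k)
    (hx : IsJointEigenvector J k a x) :
    IsJointEigenvector J k (a ∘ Equiv.swap i (i + 1)) (inter s J i • x) := by
  have hin : i + 1 < n := hi.trans_le hk
  intro j hj
  rcases eq_or_ne j i with rfl | hji
  · rw [swap_succ_left, ← mul_smul, ← hS.inter_mul_J_succ hin, mul_smul, hx _ hi, smul_comm]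
  rcases eq_or_ne j (i + 1) with rfl | hji'
  · rw [swap_succ_right, ← mul_smul, ← hS.inter_mul_J hin, mul_smul, hx i (by omega), smul_comm]
  · rw [swap_succ_of_ne hji hji', ← mul_smul,
      ← (hS.commute_inter_J hin (hj.trans_le hk) hji hji').eq, mul_smul, hx j hj, smul_comm]

theorem eq_zero_of_s_smul_eq_zero (hS : IsJMSystem q v n s J) (hi : i + 1 < n)
    (hx : s i • x = 0) : x = 0 := by
  have h : (s i * s i) • x = 0 := by rw [mul_smul, hx, smul_zero]
  rwa [hS.s_mul_self i hi, add_smul, smul_assoc, hx, smul_zero, zero_add, one_smul] at h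

theorem eq_zero_of_J_smul_eq_zero (hS : IsJMSystem q v n s J) (hv : ∀ j, v j ≠ 0) (hi : i < n)
    (hx : J i • x = 0) : x = 0 := by
  induction i generalizing x with
  | zero =>
    by_contra hx0
    obtain ⟨j, -, hj⟩ := exists_eq_of_aeval_prod_X_sub_C_eq_zero hS.cyclotomic hx0
      (hx.trans (zero_smul K x).symm)
    exact hv j hj.symm
  | succ i ih =>
    rw [hS.J_succ i hi, mul_smul, mul_smul] at hx
    exact hS.eq_zero_of_s_smul_eq_zero hi
      (ih (Nat.lt_of_succ_lt hi) (hS.eq_zero_of_s_smul_eq_zero hi hx))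

theorem eigenvalue_ne_zero (hS : IsJMSystem q v n s J) (hv : ∀ j, v j ≠ 0) (hi : i < n)
    (hx : x ≠ 0) (hc : J i • x = c • x) : c ≠ 0 := by
  rintro rfl
  exact hx (hS.eq_zero_of_J_smul_eq_zero hv hi (hc.trans (zero_smul K x)))

theorem eq_zero_of_eq_succ (hS : IsJMSystem q v n s J) (hP : SeparatedParameters (q ^ 2) v n)
    (hi : i + 1 < n) (diag : IsDiagonalizable K (J i)) (hc : J i • x = c • x)
    (hc' : J (i + 1) • x = c • x) : x = 0 := by
  by_contra hx
  have hJs : aeval (J i) (X - C c) • s i • x = -(((q - q⁻¹) * c) • x) := by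
    rw [aeval_X_sub_C_smul, ← mul_smul, hS.J_mul_s hi, sub_smul, mul_smul, hc', smul_comm,
      smul_assoc, hc', smul_smul, sub_sub_cancel_left]
  have hzero : aeval (J i) (X - C c) • s i • x = 0 := by
    refine diag.aeval_X_sub_C_smul_eq_zero ?_
    rw [hJs, smul_neg, smul_comm, smul_eq_iff_aeval_X_sub_C_smul.1 hc, smul_zero, neg_zero]
  rw [hJs, neg_eq_zero, smul_eq_zero] at hzero
  exact hzero.elim (mul_ne_zero (hP.sub_inv_ne_zero (by omega))
    (hS.eigenvalue_ne_zero hP.v_ne_zero (Nat.lt_of_succ_lt hi) hx hc)) hx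

theorem braid_eigenvalues_eq (hS : IsJMSystem q v n s J) (hi : i + 2 < n) (hx : x ≠ 0)
    (hc : s i • x = c • x) (hd : s (i + 1) • x = d • x) : c = d := by
  have ne_zero : ∀ (j : ℕ) (e : K), j + 1 < n → s j • x = e • x → e ≠ 0 := by
    rintro j e hj he rfl
    exact hx (hS.eq_zero_of_s_smul_eq_zero hj (he.trans (zero_smul K x)))
  have hc0 := ne_zero i c (by omega) hc
  have hd0 := ne_zero (i + 1) d hi hd
  have braid : (c * d * c) • x = (d * c * d) • x := by
    calc (c * d * c) • x = (s i * s (i + 1) * s i) • x := by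
          rw [mul_smul (s i * _), mul_smul (s i), hc, smul_comm _ c, hd, smul_comm (s i) c,
            smul_comm (s i) d, hc, smul_smul, smul_smul, mul_assoc]
      _ = (d * c * d) • x := by
          rw [hS.braid i hi, mul_smul (_ * s i), mul_smul _ (s i), hd, smul_comm _ d, hc,
            smul_comm (s (i + 1)) d, smul_comm (s (i + 1)) c, hd, smul_smul, smul_smul, mul_assoc]
  have hcd : c * d * c = d * c * d := smul_left_injective K hx braid
  exact mul_left_cancel₀ (mul_ne_zero hc0 hd0) (by linear_combination hcd)

theorem eigenvalue_ne_succ (hS : IsJMSystem q v n s J) (hP : SeparatedParameters (q ^ 2) v n)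
    (hi : i + 1 < n) (diag : IsDiagonalizable K (J i)) (hx : x ≠ 0) (hc : J i • x = c • x)
    (hd : J (i + 1) • x = d • x) : c ≠ d := by
  rintro rfl
  exact hx (hS.eq_zero_of_eq_succ hP hi diag hc hd)

theorem s_smul_of_inter_smul_eq_zero (hS : IsJMSystem q v n s J) (hi : i + 1 < n)
    (hc : J i • x = c • x) (hd : J (i + 1) • x = d • x) (hcd : c ≠ d)
    (h : inter s J i • x = 0) : s i • x = (-((q - q⁻¹) * d) / (c - d)) • x := by
  rw [hS.inter_smul hi hc hd] at h
  rw [div_eq_inv_mul, mul_smul, neg_smul, ← eq_neg_of_add_eq_zero_left h,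
    inv_smul_smul₀ (sub_ne_zero.2 hcd)]

/-- Both intertwiners would create two equal neighbouring eigenvalues, hence kill the vector, so
that it is an eigenvector of both generators in a braid relation. -/
theorem eigenvalue_ne_add_two (hS : IsJMSystem q v n s J) (hP : SeparatedParameters (q ^ 2) v n)
    (hi : i + 2 < n) (diag : IsDiagonalizable K (J i)) (diag' : IsDiagonalizable K (J (i + 1)))
    (hx : x ≠ 0) (hc : J i • x = c • x) (hd : J (i + 1) • x = d • x) (hcd : d + c ≠ 0) :
    J (i + 2) • x ≠ c • x := by
  intro hc'
  have hi' : i + 1 < n := Nat.lt_of_succ_lt hi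
  have hcd' : c ≠ d := hS.eigenvalue_ne_succ hP hi' diag hx hc hd
  have inter_zero : inter s J i • x = 0 := by
    refine hS.eq_zero_of_eq_succ hP hi diag' (c := c) ?_ ?_
    · rw [← mul_smul, ← hS.inter_mul_J hi', mul_smul, hc, smul_comm]
    · rw [← mul_smul, ← (hS.commute_inter_J hi' hi (by omega) (by omega)).eq, mul_smul, hc',
        smul_comm]
  have inter_zero' : inter s J (i + 1) • x = 0 := by
    refine hS.eq_zero_of_eq_succ hP hi' diag (c := c) ?_ ?_
    · rw [← mul_smul, ← (hS.commute_inter_J hi (by omega) (by omega) (by omega)).eq, mul_smul,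
        hc, smul_comm]
    · rw [← mul_smul, ← hS.inter_mul_J_succ hi, mul_smul, hc', smul_comm]
  have eigenvalues_eq := hS.braid_eigenvalues_eq hi hx
    (hS.s_smul_of_inter_smul_eq_zero hi' hc hd hcd' inter_zero)
    (hS.s_smul_of_inter_smul_eq_zero hi hd hc' hcd'.symm inter_zero')
  rw [div_eq_div_iff (sub_ne_zero.2 hcd') (sub_ne_zero.2 hcd'.symm)] at eigenvalues_eq
  have product_zero : (q - q⁻¹) * ((c - d) * (d + c)) = 0 := by linear_combination eigenvalues_eq
  exact mul_ne_zero (hP.sub_inv_ne_zero (by omega)) (mul_ne_zero (sub_ne_zero.2 hcd') hcd)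
    product_zero

theorem not_isThinReturn (hS : IsJMSystem q v n s J) (hP : SeparatedParameters (q ^ 2) v n)
    (hk : k < n) (diag : ∀ i < k, IsDiagonalizable K (J i)) {t : K}
    (ht : t = q ^ 2 ∨ t = (q ^ 2)⁻¹) {p r : ℕ} (hr : r ≤ k) (hx : x ≠ 0)
    (ha : IsJointEigenvector J (k + 1) a x) : ¬ IsThinReturn t a p r := by
  induction h : r - p generalizing p r a x with
  | zero => exact fun ret => absurd ret.lt (by omega)
  | succ e ih =>
    intro ret
    obtain ⟨w, rfl⟩ := Nat.exists_eq_succ_of_ne_zero (Nat.ne_zero_of_lt ret.lt)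
    have ht_ne : t ≠ -1 := by
      rcases ht with rfl | rfl
      · exact hP.Q_ne_neg_one (by omega)
      · exact fun h => hP.Q_ne_neg_one (by omega : 2 ≤ n) (inv_injective (h.trans inv_neg_one.symm))
    have eigen_ne_zero : ∀ i ≤ k, a i ≠ 0 := fun i hi =>
      hS.eigenvalue_ne_zero hP.v_ne_zero (by omega) hx (ha i (by omega))
    have separated : ∀ u, p < u → u < w + 1 →
        Separated (q ^ 2) (a u) (a (w + 1)) ∨ a (w + 1) = t * a u := fun u hpu hu =>
      separated_or_eq_mul hP.Q_ne_zero ht (ret.ne u hpu hu) (ret.ne_mul u hpu hu)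
    rcases (Nat.le_of_lt_succ ret.lt).eq_or_lt with rfl | hpw
    · exact hS.eigenvalue_ne_succ hP (by omega) (diag p (by omega)) hx (ha p (by omega))
        (ha (p + 1) (by omega)) ret.eq
    rcases separated w hpw w.lt_succ_self with sep | hw
    · exact ih (by omega) (hS.inter_smul_ne_zero hP.q_ne_zero (by omega) hx (ha w (by omega))
        (ha (w + 1) (by omega)) sep.2.1 sep.2.2)
        (hS.isJointEigenvector_inter_smul hk (by omega) ha) (by omega) (ret.shrink_right hpw)
    rcases separated (p + 1) p.lt_succ_self (by omega) with sep | hp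
    · rw [← ret.eq] at sep
      exact ih hr (hS.inter_smul_ne_zero hP.q_ne_zero (by omega) hx (ha p (by omega))
        (ha (p + 1) (by omega)) sep.2.2 sep.2.1)
        (hS.isJointEigenvector_inter_smul hk (by omega) ha) (by omega)
        (ret.shrink_left (by omega))
    obtain rfl : w = p + 1 := ret.subsingleton ⟨hpw, w.lt_succ_self, hw⟩
      ⟨p.lt_succ_self, by omega, hp⟩
    refine hS.eigenvalue_ne_add_two hP (by omega) (diag p (by omega)) (diag (p + 1) (by omega)) hx
      (ha p (by omega)) (ha (p + 1) (by omega)) ?_ (by rw [ret.eq]; exact ha (p + 2) (by omega))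
    rw [ret.eq, hp, ← one_add_mul]
    exact mul_ne_zero (fun h0 => ht_ne (by linear_combination h0)) (eigen_ne_zero _ (by omega))

theorem exists_eq_of_separated (hS : IsJMSystem q v n s J) (hq : q ≠ 0) (hk : k ≤ n)
    (hi : i < k) (hx : x ≠ 0) (ha : IsJointEigenvector J k a x)
    (sep : ∀ p < i, Separated (q ^ 2) (a p) (a i)) : ∃ j, a i = v j := by
  induction i generalizing a x with
  | zero =>
    obtain ⟨j, -, hj⟩ := exists_eq_of_aeval_prod_X_sub_C_eq_zero hS.cyclotomic hx (ha 0 hi)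
    exact ⟨j, hj⟩
  | succ i ih =>
    have sep_i := sep i i.lt_succ_self
    obtain ⟨j, hj⟩ := ih (Nat.lt_of_succ_lt hi) (hS.inter_smul_ne_zero hq (hi.trans_le hk) hx
      (ha i (Nat.lt_of_succ_lt hi)) (ha (i + 1) hi) sep_i.2.1 sep_i.2.2)
      (hS.isJointEigenvector_inter_smul hk hi ha) fun p hp => by
        rw [swap_succ_left, swap_succ_of_ne hp.ne (hp.trans i.lt_succ_self).ne]
        exact sep p (hp.trans i.lt_succ_self)
    exact ⟨j, by rwa [swap_succ_left] at hj⟩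

theorem appendable_of_isJointEigenvector (hS : IsJMSystem q v n s J)
    (hP : SeparatedParameters (q ^ 2) v n) (hk : k < n)
    (diag : ∀ i < k, IsDiagonalizable K (J i)) (hx : x ≠ 0)
    (ha : IsJointEigenvector J (k + 1) a x) (content : IsContentString (q ^ 2) v k a) :
    Appendable (q ^ 2) v k a (a k) := by
  have neighbour : ∀ t, t = q ^ 2 ∨ t = (q ^ 2)⁻¹ → ∀ i < k, a i = a k →
      ∃ p, i < p ∧ p < k ∧ a p = t * a k := by
    intro t ht i hi hik
    by_contra! hne
    obtain ⟨p, ret⟩ := content.exists_isThinReturn hP.Q_ne_zero ht hi hik hne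
    exact hS.not_isThinReturn hP hk diag ht le_rfl hx ha ret
  refine ⟨?_, fun i hi hik => ⟨neighbour _ (Or.inl rfl) i hi hik, ?_⟩⟩
  · by_contra! hno
    have sep : ∀ p < k, Separated (q ^ 2) (a p) (a k) := by
      refine fun p hp => ⟨fun hpk => ?_, hno.2 p hp⟩
      obtain ⟨w, -, hw, haw⟩ := neighbour _ (Or.inl rfl) p hp hpk
      exact (hno.2 w hw).1 haw
    obtain ⟨j, hj⟩ := hS.exists_eq_of_separated hP.q_ne_zero hk k.lt_succ_self hx ha sep
    exact hno.1 j hj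
  · obtain ⟨p, hip, hpk, hp⟩ := neighbour _ (Or.inr rfl) i hi hik
    exact ⟨p, hip, hpk, by rw [hp, mul_inv_cancel_left₀ hP.Q_ne_zero]⟩

theorem isContentString_of_isJointEigenvector (hS : IsJMSystem q v n s J)
    (hP : SeparatedParameters (q ^ 2) v n) (hk : k ≤ n)
    (diag : ∀ i, i + 1 < k → IsDiagonalizable K (J i)) (hx : x ≠ 0)
    (ha : IsJointEigenvector J k a x) : IsContentString (q ^ 2) v k a := by
  induction k with
  | zero => exact fun i hi => absurd hi i.not_lt_zero
  | succ k ih =>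
    have content := ih (Nat.le_of_succ_le hk) (fun i hi => diag i (by omega)) (ha.mono k.le_succ)
    intro i hi
    rcases (Nat.le_of_lt_succ hi).lt_or_eq with hik | rfl
    · exact content i hik
    · exact hS.appendable_of_isJointEigenvector hP hk (fun j hj => diag j (by omega)) hx ha content

theorem aeval_smul_inter_smul_eq_zero (hS : IsJMSystem q v n s J) (hi : i + 1 < n)
    (diag : IsDiagonalizable K (J i))
    (h : aeval (J (i + 1)) (X - C d) • aeval (J (i + 1)) (X - C d) • x = 0) :
    aeval (J i) (X - C d) • inter s J i • x = 0 := by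
  refine diag.aeval_X_sub_C_smul_eq_zero ?_
  rw [← mul_smul _ (inter s J i), ← hS.inter_mul_aeval_succ hi, ← mul_smul, ← mul_assoc,
    ← hS.inter_mul_aeval_succ hi, mul_assoc, mul_smul, mul_smul, h, smul_zero]

theorem inter_smul_eq_zero_of_neighbours (hS : IsJMSystem q v n s J)
    (hP : SeparatedParameters (q ^ 2) v n) (hk : k + 1 < n)
    (diag : ∀ i < k, IsDiagonalizable K (J i)) (ha : IsJointEigenvector J (k + 1) a x)
    (hd : J k • inter s J k • x = d • inter s J k • x) (had : a k = q ^ 2 * d ∨ d = q ^ 2 * a k) :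
    inter s J k • x = 0 := by
  by_contra hne
  have hx : x ≠ 0 := by
    rintro rfl
    exact hne (smul_zero _)
  have content : ∀ {b : ℕ → K} {y : V}, y ≠ 0 → IsJointEigenvector J (k + 1) b y →
      IsContentString (q ^ 2) v (k + 1) b := fun hy hb =>
    hS.isContentString_of_isJointEigenvector hP hk.le (fun i hi => diag i (by omega)) hy hb
  have hb : IsJointEigenvector J (k + 1) (Function.update a k d) (inter s J k • x) :=
    IsJointEigenvector.succ ((ha.mono k.le_succ).smul_of_commute fun i hi =>
      hS.commute_inter_J hk (by omega) (by omega) (by omega)) hd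
  refine (content hx ha).not_neighbours hP hk (content hne hb)
    (fun i hi => (Function.update_of_ne hi.ne _ _).symm) ?_
  rwa [Function.update_self]

/-- Otherwise the intertwiner kills `z = (J (k + 1) - d) x`, so the eigenvalues `a k` and `d` of `z`
are neighbours, and then it kills `x`. By the formula for its square, `z` is then an eigenvector of
`J (k + 1)` for two distinct eigenvalues. -/
theorem aeval_X_sub_C_smul_eq_zero_of_isJointEigenvector (hS : IsJMSystem q v n s J)
    (hP : SeparatedParameters (q ^ 2) v n) (hk : k + 1 < n)
    (diag : ∀ i ≤ k, IsDiagonalizable K (J i)) (ha : IsJointEigenvector J (k + 1) a x)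
    (h : aeval (J (k + 1)) (X - C d) • aeval (J (k + 1)) (X - C d) • x = 0) :
    aeval (J (k + 1)) (X - C d) • x = 0 := by
  by_contra hz
  have hJz := smul_eq_iff_aeval_X_sub_C_smul.2 h
  have haz : J k • aeval (J (k + 1)) (X - C d) • x = a k • aeval (J (k + 1)) (X - C d) • x :=
    ha.smul_of_commute (fun i hi => (commute_of_mem_jmAlgebra
      (fun j hj => hS.commute_J i j (by omega) hj) (aeval_mem_jmAlgebra hk _)).symm)
      k k.lt_succ_self
  have inter_x := hS.aeval_smul_inter_smul_eq_zero hk (diag k le_rfl) h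
  have inter_z : inter s J k • aeval (J (k + 1)) (X - C d) • x = 0 := by
    rw [← mul_smul, hS.inter_mul_aeval_succ hk, mul_smul, inter_x]
  have neighbours : a k = q ^ 2 * d ∨ d = q ^ 2 * a k := by
    by_contra! hne
    exact hS.inter_smul_ne_zero hP.q_ne_zero hk hz haz hJz hne.1 hne.2 inter_z
  have inter_inter := hS.inter_inter_smul hP.q_ne_zero hk (ha k k.lt_succ_self)
  rw [hS.inter_smul_eq_zero_of_neighbours hP hk (fun i hi => diag i hi.le) ha
    (smul_eq_iff_aeval_X_sub_C_smul.2 inter_x) neighbours, smul_zero, eq_comm, neg_eq_zero]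
    at inter_inter
  have eq_of_root : ∀ e, aeval (J (k + 1)) (X - C e) • aeval (J (k + 1)) (X - C d) • x = 0 →
      d = e := fun e he => smul_left_injective K hz
    (hJz.symm.trans (smul_eq_iff_aeval_X_sub_C_smul.2 he))
  have roots_ne := hP.mul_ne_inv_mul (by omega) (hS.eigenvalue_ne_zero hP.v_ne_zero
    (by omega) hz haz)
  rcases neighbours with had | had
  · have hd : d = (q ^ 2)⁻¹ * a k := by rw [had, inv_mul_cancel_left₀ hP.Q_ne_zero]
    rw [← hd] at inter_inter roots_ne
    exact roots_ne (eq_of_root _ inter_inter).symm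
  · rw [← had, aeval_smul_comm] at inter_inter
    rw [← had] at roots_ne
    exact roots_ne (eq_of_root _ inter_inter)

theorem aeval_mul_aeval_smul_eq_zero (hS : IsJMSystem q v n s J) (hq : q ≠ 0) (hi : i + 1 < n)
    {p : K[X]} (hp : aeval (J i) p = 0) (hc : J i • x = c • x) :
    aeval (J (i + 1)) (p * ((X - C (q ^ 2 * c)) * (X - C ((q ^ 2)⁻¹ * c)))) • x = 0 := by
  rw [map_mul, map_mul, mul_smul, mul_smul, ← neg_eq_zero, ← smul_neg,
    ← hS.inter_inter_smul hq hi hc, ← mul_smul, ← hS.inter_mul_aeval hi, hp, mul_zero, zero_smul]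

theorem isDiagonalizable_J_zero (hS : IsJMSystem q v n s J) (hv : Function.Injective v) :
    IsDiagonalizable K (J 0) := by
  classical
  refine ⟨Finset.univ.image v, ?_⟩
  rw [Finset.prod_image hv.injOn]
  exact hS.cyclotomic

theorem isDiagonalizable_J_succ (hS : IsJMSystem q v n s J)
    (hP : SeparatedParameters (q ^ 2) v n) (hk : k + 1 < n)
    (diag : ∀ i ≤ k, IsDiagonalizable K (J i)) : IsDiagonalizable K (J (k + 1)) := by
  classical
  obtain ⟨S, hSJ⟩ := diag k le_rfl
  let S' := S ∪ (S.image (q ^ 2 * ·) ∪ S.image ((q ^ 2)⁻¹ * ·))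
  have comm : ∀ p : K[X], ∀ i < k + 1, Commute (aeval (J (k + 1)) p) (J i) := fun p i hi =>
    (commute_of_mem_jmAlgebra (fun j hj => hS.commute_J i j (by omega) hj)
      (aeval_mem_jmAlgebra hk p)).symm
  have annihilates : ∀ (b : ℕ → K) (w : A), IsJointEigenvector J (k + 1) b w →
      aeval (J (k + 1)) (∏ c ∈ S', (X - C c)) • w = 0 := by
    intro b w hw
    rcases eq_or_ne w 0 with rfl | hw0
    · exact smul_zero _
    have hwk := hw k k.lt_succ_self
    obtain ⟨c, hcS, hbc⟩ := exists_eq_of_aeval_prod_X_sub_C_eq_zero hSJ hw0 hwk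
    have dvd := prod_X_sub_C_mul_dvd_mul_self (S := S) (T := S') Finset.subset_union_left
      (Finset.mem_union_right _ (Finset.mem_union_left _ (Finset.mem_image_of_mem _ hcS)))
      (Finset.mem_union_right _ (Finset.mem_union_right _ (Finset.mem_image_of_mem _ hcS)))
      (hP.mul_ne_inv_mul (by omega) (hbc ▸ hS.eigenvalue_ne_zero hP.v_ne_zero (by omega) hw0 hwk))
    rw [hbc] at hwk
    refine aeval_prod_X_sub_C_smul_eq_zero (M := {y : A | IsJointEigenvector J (k + 1) b y})
      (fun y hy p => IsJointEigenvector.smul_of_commute hy (comm p)) (fun y hy c =>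
      hS.aeval_X_sub_C_smul_eq_zero_of_isJointEigenvector hP hk diag hy) S' hw ?_
    obtain ⟨r, hr⟩ := dvd
    rw [← mul_smul, ← map_mul, hr, mul_comm, map_mul, mul_smul,
      hS.aeval_mul_aeval_smul_eq_zero hP.q_ne_zero hk hSJ hwk, smul_zero]
  have le_ker : Submodule.span K (jointComponents K J (k + 1) (1 : A)) ≤
      LinearMap.ker (LinearMap.mulLeft K (aeval (J (k + 1)) (∏ c ∈ S', (X - C c)))) :=
    Submodule.span_le.2 fun w ⟨_, b, hb⟩ => annihilates b w hb
  have one_mem := mem_span_jointComponents (fun i hi => diag i (Nat.le_of_lt_succ hi))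
    (fun i hi j hj => hS.commute_J i j (by omega) (by omega)) (1 : A)
  exact ⟨S', by simpa using le_ker one_mem⟩

theorem isDiagonalizable_J (hS : IsJMSystem q v n s J) (hP : SeparatedParameters (q ^ 2) v n)
    (hi : i < n) : IsDiagonalizable K (J i) := by
  induction i using Nat.strong_induction_on with
  | _ i ih =>
    cases i with
    | zero => exact hS.isDiagonalizable_J_zero (hP.v_injective hi)
    | succ k => exact hS.isDiagonalizable_J_succ hP hi fun j hj => ih j (by omega) (by omega)

end IsJMSystem
end Spectrum

/-! ### Multiplicity one -/

section MultiplicityOne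

/-- The subalgebra `Hₖ` generated by `J 0` and `s 0, …, s (k - 2)`. -/
def parabolic (K : Type*) {A : Type*} [Field K] [Ring A] [Algebra K A] (s J : ℕ → A) (k : ℕ) :
    Subalgebra K A :=
  Algebra.adjoin K (insert (J 0) (s '' {i | i + 1 < k}))

/-- The space `Hₖ₊₁ K[J (k + 1)] + Hₖ₊₁ s k Hₖ₊₁`, which turns out to contain `Hₖ₊₂`. -/
def mackeySpan (K : Type*) {A : Type*} [Field K] [Ring A] [Algebra K A] (s J : ℕ → A) (k : ℕ) :
    Submodule K A :=
  Submodule.span K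
    ({z | ∃ h ∈ parabolic K s J (k + 1), ∃ j : ℕ, z = h * J (k + 1) ^ j} ∪
      {z | ∃ h ∈ parabolic K s J (k + 1), ∃ h' ∈ parabolic K s J (k + 1), z = h * s k * h'})

/-- The space `Hₖ x` spanned by a vector `x` under the subalgebra `Hₖ = parabolic K s J k`. -/
def parabolicSpan (K : Type*) {A V : Type*} [Field K] [Ring A] [Algebra K A] [AddCommGroup V]
    [Module K V] [Module A V] [IsScalarTower K A V] (s J : ℕ → A) (k : ℕ) (x : V) :
    Submodule K V :=
  (Subalgebra.toSubmodule (parabolic K s J k)).map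
    ((LinearMap.toSpanSingleton A V x).restrictScalars K)

variable {K A V : Type*} [Field K] [Ring A] [Algebra K A] [AddCommGroup V] [Module K V]
  [Module A V] [IsScalarTower K A V]
  {m n k : ℕ} {q : K} {v : Fin m → K} {s J : ℕ → A} {a : ℕ → K} {x : V} {d : K}

theorem s_mem_parabolic {i : ℕ} (hi : i + 1 < k) : s i ∈ parabolic K s J k :=
  Algebra.subset_adjoin (Or.inr ⟨i, hi, rfl⟩)

theorem parabolic_mono {l : ℕ} (hkl : k ≤ l) : parabolic K s J k ≤ parabolic K s J l :=
  Algebra.adjoin_mono (Set.insert_subset_insert (Set.image_mono fun _ hi => hi.trans_le hkl))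

theorem exists_aeval_eq_of_mem_parabolic_one {z : A} (hz : z ∈ parabolic K s J 1) :
    ∃ p : K[X], aeval (J 0) p = z := by
  have image_empty : s '' {i | i + 1 < 1} = ∅ := by simp
  rwa [parabolic, image_empty, insert_empty_eq, Algebra.adjoin_singleton_eq_range_aeval] at hz

theorem mul_pow_mem_mackeySpan {h : A} (hh : h ∈ parabolic K s J (k + 1)) (j : ℕ) :
    h * J (k + 1) ^ j ∈ mackeySpan K s J k :=
  Submodule.subset_span (Or.inl ⟨h, hh, j, rfl⟩)

theorem mul_s_mul_mem_mackeySpan {h h' : A} (hh : h ∈ parabolic K s J (k + 1))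
    (hh' : h' ∈ parabolic K s J (k + 1)) : h * s k * h' ∈ mackeySpan K s J k :=
  Submodule.subset_span (Or.inr ⟨h, hh, h', hh', rfl⟩)

omit [Module A V] [IsScalarTower K A V] in
theorem mackeySpan_induction (f : A →ₗ[K] V) (N : Submodule K V)
    (mul_pow : ∀ h ∈ parabolic K s J (k + 1), ∀ j : ℕ, f (h * J (k + 1) ^ j) ∈ N)
    (mul_s_mul : ∀ h ∈ parabolic K s J (k + 1), ∀ h' ∈ parabolic K s J (k + 1),
      f (h * s k * h') ∈ N) {z : A} (hz : z ∈ mackeySpan K s J k) : f z ∈ N := by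
  suffices mackeySpan K s J k ≤ N.comap f from this hz
  refine Submodule.span_le.2 ?_
  rintro _ (⟨h, hh, j, rfl⟩ | ⟨h, hh, h', hh', rfl⟩)
  · exact mul_pow h hh j
  · exact mul_s_mul h hh h' hh'

theorem mul_mem_mackeySpan_left {r z : A} (hr : r ∈ parabolic K s J (k + 1))
    (hz : z ∈ mackeySpan K s J k) : r * z ∈ mackeySpan K s J k := by
  refine mackeySpan_induction (LinearMap.mulLeft K r) _ (fun h hh j => ?_)
    (fun h hh h' hh' => ?_) hz
  · rw [LinearMap.mulLeft_apply, ← mul_assoc]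
    exact mul_pow_mem_mackeySpan (mul_mem hr hh) j
  · rw [LinearMap.mulLeft_apply, ← mul_assoc, ← mul_assoc]
    exact mul_s_mul_mem_mackeySpan (mul_mem hr hh) hh'

namespace IsJMSystem

theorem J_succ_mul_s (hS : IsJMSystem q v n s J) {i : ℕ} (hi : i + 1 < n) :
    J (i + 1) * s i = s i * J i + (q - q⁻¹) • J (i + 1) := by
  rw [hS.J_succ i hi, mul_assoc _ (s i) (s i), hS.s_mul_self i hi, mul_add, mul_one,
    mul_smul_comm, add_comm]

theorem J_mem_parabolic (hS : IsJMSystem q v n s J) (hk : k < n) :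
    J k ∈ parabolic K s J (k + 1) := by
  induction k with
  | zero => exact Algebra.subset_adjoin (Set.mem_insert _ _)
  | succ k ih =>
    have hs : s k ∈ parabolic K s J (k + 2) := s_mem_parabolic (by omega)
    rw [hS.J_succ k hk]
    exact mul_mem (mul_mem hs (parabolic_mono (k + 1).le_succ (ih (by omega)))) hs

theorem commute_J_parabolic (hS : IsJMSystem q v n s J) (hk : 0 < k) (hkn : k < n) {h : A}
    (hh : h ∈ parabolic K s J k) : Commute (J k) h := by
  refine Algebra.commute_of_mem_adjoin_of_forall_mem_commute hh ?_
  rintro _ (rfl | ⟨i, hi, rfl⟩)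
  · exact hS.commute_J k 0 hkn (hk.trans hkn)
  · exact (hS.commute_s_J i k (lt_trans hi hkn) hkn (Nat.lt_of_succ_lt hi).ne' hi.ne').symm

theorem commute_s_parabolic (hS : IsJMSystem q v n s J) (hk : 0 < k) (hkn : k + 1 < n) {h : A}
    (hh : h ∈ parabolic K s J k) : Commute (s k) h := by
  refine Algebra.commute_of_mem_adjoin_of_forall_mem_commute hh ?_
  rintro _ (rfl | ⟨i, hi, rfl⟩)
  · exact hS.commute_s_J k 0 hkn (by omega) hk.ne (by omega)
  · exact (hS.commute_s i k hkn hi).symm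

theorem mul_mem_mackeySpan_right (hS : IsJMSystem q v n s J) (hk : k + 1 < n) {r z : A}
    (hr : r ∈ parabolic K s J (k + 1)) (hz : z ∈ mackeySpan K s J k) :
    z * r ∈ mackeySpan K s J k := by
  refine mackeySpan_induction (LinearMap.mulRight K r) _ (fun h hh j => ?_)
    (fun h hh h' hh' => ?_) hz
  · rw [LinearMap.mulRight_apply, mul_assoc,
      ((hS.commute_J_parabolic k.succ_pos hk hr).pow_left j).eq, ← mul_assoc]
    exact mul_pow_mem_mackeySpan (mul_mem hh hr) j
  · rw [LinearMap.mulRight_apply, mul_assoc]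
    exact mul_s_mul_mem_mackeySpan hh (mul_mem hh' hr)

theorem mul_J_mem_mackeySpan (hS : IsJMSystem q v n s J) (hk : k + 1 < n) {z : A}
    (hz : z ∈ mackeySpan K s J k) : z * J (k + 1) ∈ mackeySpan K s J k := by
  refine mackeySpan_induction (LinearMap.mulRight K (J (k + 1))) _ (fun h hh j => ?_)
    (fun h hh h' hh' => ?_) hz
  · rw [LinearMap.mulRight_apply, mul_assoc, ← pow_succ]
    exact mul_pow_mem_mackeySpan hh _
  · have s_mul_J : s k * J (k + 1) = J k * s k + (q - q⁻¹) • J (k + 1) := by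
      rw [hS.J_mul_s hk, sub_add_cancel]
    rw [LinearMap.mulRight_apply, mul_assoc, ← (hS.commute_J_parabolic k.succ_pos hk hh').eq,
      ← mul_assoc, mul_assoc h, s_mul_J, mul_add, add_mul, ← mul_assoc, mul_smul_comm,
      smul_mul_assoc, mul_assoc h (J (k + 1)), (hS.commute_J_parabolic k.succ_pos hk hh').eq,
      ← mul_assoc h h']
    have h_pow := mul_pow_mem_mackeySpan (J := J) (mul_mem hh hh') 1
    rw [pow_one] at h_pow
    exact add_mem (mul_s_mul_mem_mackeySpan
      (mul_mem hh (hS.J_mem_parabolic (Nat.lt_of_succ_lt hk))) hh') (Submodule.smul_mem _ _ h_pow)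

theorem s_mul_pow_mul_s_mem_mackeySpan (hS : IsJMSystem q v n s J) (hk : k + 1 < n) (j : ℕ) :
    s k * J k ^ j * s k ∈ mackeySpan K s J k := by
  have s_mem : s k ∈ mackeySpan K s J k := by
    simpa using mul_s_mul_mem_mackeySpan (s := s) (J := J) (k := k) (one_mem (parabolic K s J _))
      (one_mem _)
  induction j with
  | zero =>
    rw [pow_zero, mul_one, hS.s_mul_self k hk]
    refine add_mem (Submodule.smul_mem _ _ s_mem) ?_
    simpa using mul_pow_mem_mackeySpan (one_mem (parabolic K s J (k + 1))) 0
  | succ j ih =>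
    rw [pow_succ, ← mul_assoc, mul_assoc _ (J k), hS.J_mul_s hk, mul_sub, mul_smul_comm,
      ← mul_assoc]
    exact sub_mem (hS.mul_J_mem_mackeySpan hk ih) (Submodule.smul_mem _ _
      (hS.mul_J_mem_mackeySpan hk (hS.mul_mem_mackeySpan_right hk
        (pow_mem (hS.J_mem_parabolic (Nat.lt_of_succ_lt hk)) j) s_mem)))

theorem s_mul_mem_mackeySpan (hS : IsJMSystem q v n s J) (hk : k + 1 < n)
    (s_mul_s : ∀ g ∈ parabolic K s J (k + 1), s k * g * s k ∈ mackeySpan K s J k) {z : A}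
    (hz : z ∈ mackeySpan K s J k) : s k * z ∈ mackeySpan K s J k := by
  refine mackeySpan_induction (LinearMap.mulLeft K (s k)) _ (fun h hh j => ?_)
    (fun h hh h' hh' => ?_) hz
  · have mul_pow_mem : s k * h * J (k + 1) ^ j ∈ mackeySpan K s J k := by
      induction j with
      | zero => simpa using mul_s_mul_mem_mackeySpan (J := J) (one_mem _) hh
      | succ j ih =>
        rw [pow_succ, ← mul_assoc]
        exact hS.mul_J_mem_mackeySpan hk ih
    rwa [LinearMap.mulLeft_apply, ← mul_assoc]
  · rw [LinearMap.mulLeft_apply, ← mul_assoc, ← mul_assoc]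
    exact hS.mul_mem_mackeySpan_right hk hh' (s_mul_s h hh)

theorem mem_mackeySpan_of_s_mul_s (hS : IsJMSystem q v n s J) (hk : k + 1 < n)
    (s_mul_s : ∀ g ∈ parabolic K s J (k + 1), s k * g * s k ∈ mackeySpan K s J k) {z : A}
    (hz : z ∈ parabolic K s J (k + 2)) : z ∈ mackeySpan K s J k := by
  suffices stable : ∀ w ∈ mackeySpan K s J k, z * w ∈ mackeySpan K s J k by
    simpa using stable 1 (by simpa using mul_pow_mem_mackeySpan (one_mem (parabolic K s J _)) 0)
  induction hz using Algebra.adjoin_induction with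
  | mem r hr =>
    intro w hw
    obtain rfl | ⟨i, hi, rfl⟩ := hr
    · exact mul_mem_mackeySpan_left (Algebra.subset_adjoin (Set.mem_insert _ _)) hw
    · rcases (Nat.lt_succ_iff.1 (Nat.lt_of_succ_lt_succ hi)).lt_or_eq with hik | rfl
      · exact mul_mem_mackeySpan_left (s_mem_parabolic (Nat.succ_lt_succ hik)) hw
      · exact hS.s_mul_mem_mackeySpan hk s_mul_s hw
  | algebraMap c =>
    intro w hw
    rw [← Algebra.smul_def]
    exact Submodule.smul_mem _ c hw
  | add r r' _ _ ih ih' =>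
    intro w hw
    rw [add_mul]
    exact add_mem (ih w hw) (ih' w hw)
  | mul r r' _ _ ih ih' =>
    intro w hw
    rw [mul_assoc]
    exact ih _ (ih' w hw)

theorem s_mul_mul_s_mem_mackeySpan (hS : IsJMSystem q v n s J) (hk : k + 1 < n) {g : A}
    (hg : g ∈ parabolic K s J (k + 1)) : s k * g * s k ∈ mackeySpan K s J k := by
  induction k generalizing g with
  | zero =>
    obtain ⟨p, rfl⟩ := exists_aeval_eq_of_mem_parabolic_one hg
    rw [aeval_eq_sum_range, Finset.mul_sum, Finset.sum_mul]
    refine sum_mem fun j _ => ?_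
    rw [mul_smul_comm, smul_mul_assoc]
    exact Submodule.smul_mem _ _ (hS.s_mul_pow_mul_s_mem_mackeySpan hk j)
  | succ k ih =>
    have hk' : k + 1 < n := Nat.lt_of_succ_lt hk
    have commute_s {h : A} (hh : h ∈ parabolic K s J (k + 1)) : s (k + 1) * h = h * s (k + 1) :=
      (hS.commute_s_parabolic k.succ_pos hk hh).eq
    have parabolic_le : parabolic K s J (k + 1) ≤ parabolic K s J (k + 2) :=
      parabolic_mono (k + 1).le_succ
    have hsk : s k ∈ parabolic K s J (k + 2) := s_mem_parabolic (Nat.lt_succ_self _)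
    refine mackeySpan_induction (LinearMap.mulRight K (s (k + 1)) ∘ₗ
      LinearMap.mulLeft K (s (k + 1))) _ (fun h hh j => ?_) (fun h hh h' hh' => ?_)
      (hS.mem_mackeySpan_of_s_mul_s hk' (fun g hg => ih hk' hg) hg)
    · have pull_out : s (k + 1) * (h * J (k + 1) ^ j) * s (k + 1) =
          h * (s (k + 1) * J (k + 1) ^ j * s (k + 1)) := by
        rw [← mul_assoc, commute_s hh]
        simp only [mul_assoc]
      simp only [LinearMap.comp_apply, LinearMap.mulLeft_apply, LinearMap.mulRight_apply, pull_out]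
      exact mul_mem_mackeySpan_left (parabolic_le hh) (hS.s_mul_pow_mul_s_mem_mackeySpan hk j)
    · have pull_out : s (k + 1) * (h * s k * h') * s (k + 1) =
          h * s k * s (k + 1) * (s k * h') := by
        calc s (k + 1) * (h * s k * h') * s (k + 1)
            = s (k + 1) * h * s k * (h' * s (k + 1)) := by simp only [mul_assoc]
          _ = h * (s (k + 1) * s k * s (k + 1)) * h' := by
            rw [commute_s hh, ← commute_s hh']
            simp only [mul_assoc]
          _ = h * s k * s (k + 1) * (s k * h') := by
            rw [← hS.braid k hk]
            simp only [mul_assoc]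
      simp only [LinearMap.comp_apply, LinearMap.mulLeft_apply, LinearMap.mulRight_apply, pull_out]
      exact mul_s_mul_mem_mackeySpan (mul_mem (parabolic_le hh) hsk)
        (mul_mem hsk (parabolic_le hh'))

theorem mem_mackeySpan_of_mem_parabolic (hS : IsJMSystem q v n s J) (hk : k + 1 < n) {z : A}
    (hz : z ∈ parabolic K s J (k + 2)) : z ∈ mackeySpan K s J k :=
  hS.mem_mackeySpan_of_s_mul_s hk (fun _ hg => hS.s_mul_mul_s_mem_mackeySpan hk hg) hz

theorem exists_aeval_smul_s_smul_eq (hS : IsJMSystem q v n s J) (hk : k + 1 < n) {p : K[X]}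
    (hp : aeval (J (k + 1)) (X - C d) * aeval (J (k + 1)) p = 0) {c : K} (hcd : c ≠ d)
    (hc : J k • x = c • x) (hd : J (k + 1) • x = d • x) :
    ∃ b : K, aeval (J (k + 1)) p • s k • x = b • x := by
  have inter_eigen : J (k + 1) • inter s J k • x = c • inter s J k • x := by
    rw [← mul_smul, ← hS.inter_mul_J hk, mul_smul, hc, smul_comm]
  have p_inter := aeval_smul_eq_zero_of_ne hp inter_eigen hcd
  rw [hS.inter_smul hk hc hd, smul_add, smul_comm _ (c - d), smul_comm _ ((q - q⁻¹) * d),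
    aeval_smul_of_smul_eq hd] at p_inter
  refine ⟨(c - d)⁻¹ * -((q - q⁻¹) * d * p.eval d), ?_⟩
  rw [mul_smul, eq_inv_smul_iff₀ (sub_ne_zero.2 hcd), neg_smul, mul_smul _ (p.eval d)]
  exact eq_neg_of_add_eq_zero_left p_inter

theorem aeval_smul_s_smul_mem_parabolicSpan (hS : IsJMSystem q v n s J)
    (hP : SeparatedParameters (q ^ 2) v n) (hk : k + 1 < n) (diag : IsDiagonalizable K (J k))
    {p : K[X]} (hp : aeval (J (k + 1)) (X - C d) * aeval (J (k + 1)) p = 0)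
    (hx : J (k + 1) • x = d • x) :
    aeval (J (k + 1)) p • s k • x ∈ parabolicSpan K s J (k + 1) x := by
  let f := Algebra.lsmul K K V (aeval (J (k + 1)) p * s k)
  suffices Submodule.span K {z | (∃ r : K[X], z = aeval (J k) r • x) ∧ ∃ c : K, J k • z = c • z} ≤
      (parabolicSpan K s J (k + 1) x).comap f by
    simpa only [f, Submodule.mem_comap, Algebra.lsmul_coe, mul_smul] using
      this (diag.mem_span_eigenvectors x)
  refine Submodule.span_le.2 ?_
  rintro _ ⟨⟨r, rfl⟩, c, hc⟩
  by_cases h0 : aeval (J k) r • x = 0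
  · rw [h0]
    exact zero_mem _
  have r_mem : aeval (J k) r ∈ parabolic K s J (k + 1) :=
    Algebra.adjoin_singleton_le (hS.J_mem_parabolic (Nat.lt_of_succ_lt hk))
      (aeval_mem_adjoin_singleton K (J k))
  have hd : J (k + 1) • aeval (J k) r • x = d • aeval (J k) r • x := by
    rw [← mul_smul, (hS.commute_J_parabolic k.succ_pos hk r_mem).eq, mul_smul, hx, smul_comm]
  obtain ⟨b, hb⟩ := hS.exists_aeval_smul_s_smul_eq hk hp
    (hS.eigenvalue_ne_succ hP hk diag h0 hc hd) hc hd
  simp only [f, SetLike.mem_coe, Submodule.mem_comap, Algebra.lsmul_coe, mul_smul, hb]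
  exact Submodule.smul_mem _ b ⟨aeval (J k) r, r_mem, rfl⟩

theorem aeval_smul_smul_mem_parabolicSpan (hS : IsJMSystem q v n s J)
    (hP : SeparatedParameters (q ^ 2) v n) (hk : k + 1 < n) (diag : IsDiagonalizable K (J k))
    {p : K[X]} (hp : aeval (J (k + 1)) (X - C d) * aeval (J (k + 1)) p = 0)
    (hx : J (k + 1) • x = d • x) {r : A} (hr : r ∈ parabolic K s J (k + 2)) :
    aeval (J (k + 1)) p • r • x ∈ parabolicSpan K s J (k + 1) x := by
  have commute_p {h : A} (hh : h ∈ parabolic K s J (k + 1)) :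
      aeval (J (k + 1)) p * h = h * aeval (J (k + 1)) p :=
    (Algebra.commute_of_mem_adjoin_singleton_of_commute (aeval_mem_adjoin_singleton K _)
      (hS.commute_J_parabolic k.succ_pos hk hh).symm).eq.symm
  refine mackeySpan_induction (Algebra.lsmul K K V (aeval (J (k + 1)) p) ∘ₗ
    (LinearMap.toSpanSingleton A V x).restrictScalars K) _ (fun h hh j => ?_)
    (fun h hh h' hh' => ?_) (hS.mem_mackeySpan_of_mem_parabolic hk hr)
  · refine ⟨(p * X ^ j).eval d • h, Subalgebra.smul_mem _ hh _, ?_⟩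
    change ((p * X ^ j).eval d • h) • x = aeval (J (k + 1)) p • (h * J (k + 1) ^ j) • x
    rw [← mul_smul, ← mul_assoc, commute_p hh, mul_assoc, mul_smul, smul_assoc, smul_comm,
      ← aeval_smul_of_smul_eq hx, map_mul, map_pow, aeval_X]
  · have h'_eigen : J (k + 1) • h' • x = d • h' • x := by
      rw [← mul_smul, (hS.commute_J_parabolic k.succ_pos hk hh').eq, mul_smul, hx, smul_comm]
    obtain ⟨g, (hg : g ∈ parabolic K s J (k + 1)),
      (hgx : g • h' • x = aeval (J (k + 1)) p • s k • h' • x)⟩ :=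
      hS.aeval_smul_s_smul_mem_parabolicSpan hP hk diag hp h'_eigen
    have mul_mem_parabolic : h * (g * h') ∈ parabolic K s J (k + 1) :=
      mul_mem hh (mul_mem hg hh')
    refine ⟨h * (g * h'), mul_mem_parabolic, ?_⟩
    change (h * (g * h')) • x = aeval (J (k + 1)) p • (h * s k * h') • x
    simp only [mul_smul, hgx]
    rw [← mul_smul h, ← commute_p hh, mul_smul]

theorem exists_eq_smul_of_mem_parabolic (hS : IsJMSystem q v n s J)
    (hP : SeparatedParameters (q ^ 2) v n) (hk : k < n) (diag : ∀ i ≤ k, IsDiagonalizable K (J i))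
    (hx : IsJointEigenvector J (k + 1) a x) {r : A} (hr : r ∈ parabolic K s J (k + 1))
    (hrx : IsJointEigenvector J (k + 1) a (r • x)) : ∃ c : K, r • x = c • x := by
  induction k generalizing r with
  | zero =>
    obtain ⟨p, rfl⟩ := exists_aeval_eq_of_mem_parabolic_one hr
    exact ⟨_, aeval_smul_of_smul_eq (hx 0 Nat.zero_lt_one) p⟩
  | succ k ih =>
    obtain ⟨p, hp, hp_eval, -⟩ := (diag (k + 1) le_rfl).exists_projections
    obtain ⟨h, hh, hhx⟩ := hS.aeval_smul_smul_mem_parabolicSpan hP hk (diag k k.le_succ)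
      (hp (a (k + 1))) (hx (k + 1) (k + 1).lt_succ_self) hr
    have r_smul : r • x = h • x := by
      rw [aeval_smul_of_smul_eq (hrx (k + 1) (k + 1).lt_succ_self), hp_eval, one_smul] at hhx
      exact hhx.symm
    rw [r_smul] at hrx ⊢
    exact ih (Nat.lt_of_succ_lt hk) (fun i hi => diag i (hi.trans k.le_succ))
      (hx.mono (k + 1).le_succ) hh (hrx.mono (k + 1).le_succ)

theorem exists_eq_smul_of_isJointEigenvector (hS : IsJMSystem q v n s J)
    (hP : SeparatedParameters (q ^ 2) v n) (hn : 0 < n) (hx : IsJointEigenvector J n a x) {r : A}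
    (hrx : IsJointEigenvector J n a (r • x)) : ∃ c : K, r • x = c • x := by
  obtain ⟨k, rfl⟩ := Nat.exists_eq_succ_of_ne_zero hn.ne'
  refine hS.exists_eq_smul_of_mem_parabolic hP k.lt_succ_self
    (fun i hi => hS.isDiagonalizable_J hP (Nat.lt_succ_of_le hi)) hx ?_ hrx
  rw [parabolic, hS.generate]
  exact Algebra.mem_top

end IsJMSystem
end MultiplicityOne

/-! ### Simple modules and centralizers -/

section SimpleModule

/-- The strings of eigenvalues of `J 0, …, J (n - 1)` on common eigenvectors in `V`. -/
def jointSpectrum (K V : Type*) {A : Type*} [Field K] [Ring A] [AddCommGroup V] [Module K V]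
    [Module A V] (J : ℕ → A) (n : ℕ) : Set (Fin n → K) :=
  {a | ∃ x : V, x ≠ 0 ∧ ∀ i : Fin n, J i • x = a i • x}

variable {K A V W : Type*} [Field K] [Ring A] [Algebra K A] [AddCommGroup V] [Module K V]
  [Module A V] [IsScalarTower K A V] [AddCommGroup W] [Module K W] [Module A W]
  [IsScalarTower K A W] {m n : ℕ} {q : K} {v : Fin m → K} {s J : ℕ → A} {a : ℕ → K}
  {x : V} {y : W}

omit [Algebra K A] [IsScalarTower K A V] in
theorem isJointEigenvector_extend {a : Fin n → K} (hx : ∀ i : Fin n, J i • x = a i • x) :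
    IsJointEigenvector J n (Function.extend Fin.val a 0) x := fun i hi => by
  rw [← Fin.val_mk hi, Fin.val_injective.extend_apply, hx]

theorem linearIndependent_of_jointEigenvectors {ι κ : Type*} {T : κ → A} {e : ι → V}
    {a : ι → κ → K} (comm : ∀ i j, Commute (T i) (T j)) (ha : Function.Injective a)
    (he : ∀ t i, T i • e t = a t i • e t) (he0 : ∀ t, e t ≠ 0) : LinearIndependent K e := by
  let f : κ → Module.End K V := fun i => Algebra.lsmul K K V (T i)
  have indep := Module.End.independent_iInf_maxGenEigenspace_of_forall_mapsTo f fun i j c =>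
    Module.End.mapsTo_maxGenEigenspace_of_comm ((comm j i).map (Algebra.lsmul K K V)) c
  have mem_eigenspace (t : ι) : e t ∈ ⨅ i, (f i).maxGenEigenspace (a t i) :=
    (Submodule.mem_iInf _).2 fun i => Module.End.mem_maxGenEigenspace _ _ _ |>.2
      ⟨1, by simp [f, he t i]⟩
  exact iSupIndep.linearIndependent (fun t => ⨅ i, (f i).maxGenEigenspace (a t i))
    (indep.comp ha) mem_eigenspace he0

namespace IsJMSystem

theorem smul_eq_zero_of_smul_eq_zero (hS : IsJMSystem q v n s J)
    (hP : SeparatedParameters (q ^ 2) v n) (hn : 0 < n) [IsSimpleModule A W] (hx0 : x ≠ 0)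
    (hx : IsJointEigenvector J n a x) (hy : IsJointEigenvector J n a y) {r : A}
    (hrx : r • x = 0) : r • y = 0 := by
  by_contra hry
  obtain ⟨t, ht : t • r • y = y⟩ := IsSimpleModule.toSpanSingleton_surjective A hry y
  have pair_eq : (t * r) • (x, y) = (0, y) := by
    rw [mul_smul, Prod.smul_mk, Prod.smul_mk, hrx, ht, smul_zero]
  have pair_joint : IsJointEigenvector J n a (x, y) := fun i hi => Prod.ext (hx i hi) (hy i hi)
  have joint : IsJointEigenvector J n a ((t * r) • (x, y)) := by
    rw [pair_eq]
    exact fun i hi => Prod.ext (by simp) (hy i hi)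
  obtain ⟨c, hc⟩ := hS.exists_eq_smul_of_isJointEigenvector hP hn pair_joint joint
  rw [pair_eq, Prod.smul_mk, Prod.mk.injEq, eq_comm, smul_eq_zero, or_iff_left hx0] at hc
  rw [hc.2, hc.1, zero_smul, smul_zero] at hry
  exact hry rfl

theorem nonempty_linearEquiv (hS : IsJMSystem q v n s J) (hP : SeparatedParameters (q ^ 2) v n)
    (hn : 0 < n) [IsSimpleModule A V] [IsSimpleModule A W] (hx0 : x ≠ 0) (hy0 : y ≠ 0)
    (hx : IsJointEigenvector J n a x) (hy : IsJointEigenvector J n a y) :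
    Nonempty (V ≃ₗ[A] W) := by
  have ker_eq : LinearMap.ker (LinearMap.toSpanSingleton A V x) =
      LinearMap.ker (LinearMap.toSpanSingleton A W y) :=
    Submodule.ext fun _ => ⟨hS.smul_eq_zero_of_smul_eq_zero hP hn hx0 hx hy,
      hS.smul_eq_zero_of_smul_eq_zero hP hn hy0 hy hx⟩
  exact ⟨(LinearMap.quotKerEquivOfSurjective _
      (IsSimpleModule.toSpanSingleton_surjective A hx0)).symm ≪≫ₗ
    Submodule.quotEquivOfEq _ _ ker_eq ≪≫ₗ LinearMap.quotKerEquivOfSurjective _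
      (IsSimpleModule.toSpanSingleton_surjective A hy0)⟩

theorem mem_span_jointComponents (hS : IsJMSystem q v n s J)
    (hP : SeparatedParameters (q ^ 2) v n) (z : V) :
    z ∈ Submodule.span K (jointComponents K J n z) :=
  CyclotomicHecke.mem_span_jointComponents (fun _ hi => hS.isDiagonalizable_J hP hi)
    (fun i hi j hj => hS.commute_J i j hi hj) z

theorem exists_basis (hS : IsJMSystem q v n s J) (hP : SeparatedParameters (q ^ 2) v n)
    (hn : 0 < n) [IsSimpleModule A V] :
    ∃ b : Module.Basis (jointSpectrum K V J n) K V,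
      ∀ (a : jointSpectrum K V J n) (i : Fin n), J i • b a = a.1 i • b a := by
  choose e he0 he using fun a : jointSpectrum K V J n => a.2
  have indep : LinearIndependent K e := linearIndependent_of_jointEigenvectors
    (fun i j : Fin n => hS.commute_J i j i.2 j.2) Subtype.val_injective he he0
  have span_top : ⊤ ≤ Submodule.span K (Set.range e) := by
    refine fun z _ => Submodule.span_le.2 ?_ (hS.mem_span_jointComponents hP z)
    rintro w ⟨-, a, ha⟩
    by_cases hw : w = 0
    · exact hw ▸ zero_mem _
    let t : jointSpectrum K V J n := ⟨fun i => a i, w, hw, fun i => ha i i.2⟩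
    obtain ⟨r, hr : r • e t = w⟩ := IsSimpleModule.toSpanSingleton_surjective A (he0 t) w
    rw [← hr] at ha
    obtain ⟨c, hc⟩ := hS.exists_eq_smul_of_isJointEigenvector hP hn (fun i hi => he t ⟨i, hi⟩) ha
    rw [SetLike.mem_coe, ← hr, hc]
    exact Submodule.smul_mem _ c (Submodule.subset_span ⟨t, rfl⟩)
  refine ⟨Module.Basis.mk indep span_top, fun a i => ?_⟩
  rw [Module.Basis.mk_apply]
  exact he a i

theorem mem_jmAlgebra_of_commute (hS : IsJMSystem q v n s J)
    (hP : SeparatedParameters (q ^ 2) v n) (hn : 0 < n) {z : A}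
    (hz : ∀ i < n, Commute z (J i)) : z ∈ jmAlgebra K J n := by
  suffices Submodule.span K (jointComponents K J n (1 : A)) ≤
      (Subalgebra.toSubmodule (jmAlgebra K J n)).comap (LinearMap.mulLeft K z) by
    simpa using this (hS.mem_span_jointComponents hP 1)
  refine Submodule.span_le.2 ?_
  rintro _ ⟨⟨r, hr, rfl⟩, a, ha⟩
  rw [smul_eq_mul, mul_one] at ha ⊢
  obtain ⟨c, hc⟩ := hS.exists_eq_smul_of_isJointEigenvector hP hn ha (ha.smul_of_commute hz)
  rw [SetLike.mem_coe, Submodule.mem_comap, LinearMap.mulLeft_apply, ← smul_eq_mul, hc]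
  exact Subalgebra.smul_mem _ hr c

theorem commute_s_J_add_J_succ (hS : IsJMSystem q v n s J) {i : ℕ} (hi : i + 1 < n) :
    Commute (s i) (J i + J (i + 1)) := by
  rw [commute_iff_eq, mul_add, add_mul, hS.J_mul_s hi, hS.J_succ_mul_s hi]
  abel

theorem sum_J_mem_center (hS : IsJMSystem q v n s J) (hn : 0 < n) :
    ∑ i ∈ Finset.range n, J i ∈ Subalgebra.center K A := by
  have commute_s (i : ℕ) (hi : i + 1 < n) : Commute (s i) (∑ j ∈ Finset.range n, J j) := by
    have mem : i ∈ Finset.range n := Finset.mem_range.2 (Nat.lt_of_succ_lt hi)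
    have succ_mem : i + 1 ∈ (Finset.range n).erase i :=
      Finset.mem_erase.2 ⟨i.succ_ne_self, Finset.mem_range.2 hi⟩
    rw [← Finset.add_sum_erase _ _ mem, ← Finset.add_sum_erase _ _ succ_mem, ← add_assoc]
    refine (hS.commute_s_J_add_J_succ hi).add_right (Commute.sum_right _ _ _ fun j hj => ?_)
    simp only [Finset.mem_erase, Finset.mem_range] at hj
    exact hS.commute_s_J i j hi hj.2.2 hj.2.1 hj.1
  refine Subalgebra.mem_center_iff.2 fun r => ?_
  have hr : r ∈ Algebra.adjoin K (insert (J 0) (s '' {i | i + 1 < n})) :=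
    hS.generate ▸ Algebra.mem_top
  refine (Algebra.commute_of_mem_adjoin_of_forall_mem_commute hr ?_).symm
  rintro _ (rfl | ⟨i, hi, rfl⟩)
  · exact Commute.sum_left _ _ _ fun i hi => hS.commute_J i 0 (Finset.mem_range.1 hi) hn
  · exact (commute_s i hi).symm

end IsJMSystem
end SimpleModule

/-! ### The cyclotomic Hecke algebra -/

section CyclotomicAlgebra

variable {m n k : ℕ} {K : Type*} [Field K] {q : K} {v : Fin m → K}

theorem jucysMurphyDistinguish {K : Type} [Field K] {q : K} {v : Fin m → K}
    (hP : SeparatedParameters (q ^ 2) v n) (hn : 0 < n) : JucysMurphyDistinguish q v n := by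
  have hS := isJMSystem_sig_jm q v hn
  have jm_eq (i : Fin n) : jucysMurphy q v i.1 i.2 = jm q v n i := (jm_of_lt q v i.2).symm
  refine ⟨fun V _ _ _ _ _ => ?_, fun V W _ _ _ _ _ _ _ _ _ _ a x y hx0 hy0 hx hy => ?_⟩
  · obtain ⟨b, hb⟩ := hS.exists_basis (V := V) hP hn
    exact ⟨_, b, Subtype.val, Subtype.val_injective, fun a i => jm_eq i ▸ hb a i⟩
  · exact hS.nonempty_linearEquiv hP hn hx0 hy0
      (isJointEigenvector_extend fun i => jm_eq i ▸ hx i)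
      (isJointEigenvector_extend fun i => jm_eq i ▸ hy i)

theorem adjoin_jucysMurphySet (q : K) (v : Fin m → K) (n : ℕ) :
    Algebra.adjoin K (jucysMurphySet q v n) = jmAlgebra K (jm q v n) n := by
  refine congrArg (Algebra.adjoin K) (Set.ext fun z => ⟨?_, ?_⟩)
  · rintro ⟨i, rfl⟩
    exact ⟨i, i.2, jm_of_lt q v i.2⟩
  · rintro ⟨i, hi, rfl⟩
    exact ⟨⟨i, hi⟩, (jm_of_lt q v hi).symm⟩

theorem isMaximalCommutativeSet_jucysMurphySet (hP : SeparatedParameters (q ^ 2) v n)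
    (hn : 0 < n) : IsMaximalCommutativeSet K (jucysMurphySet q v n) := by
  have hS := isJMSystem_sig_jm q v hn
  rw [IsMaximalCommutativeSet, adjoin_jucysMurphySet]
  refine ⟨fun x hx y hy => ?_, fun B hB hle x hx =>
    hS.mem_jmAlgebra_of_commute hP hn fun i hi => hB x hx _ (hle (mem_jmAlgebra hi))⟩
  exact commute_of_mem_jmAlgebra
    (fun i hi => (commute_of_mem_jmAlgebra (hS.commute_J i · hi) hx).symm) hy

theorem incl_sig (hkn : k ≤ n) {i : ℕ} (hi : i + 1 < k) :
    incl q v hkn (sig q v k i) = sig q v n i := by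
  rw [sig_of_lt q v hi, sig_of_lt q v (hi.trans_le hkn), sigma, incl,
    RingQuot.liftAlgHom_mkAlgHom_apply, lift_freeSigma]

theorem incl_jm (hkn : k ≤ n) {i : ℕ} (hi : i < k) :
    incl q v hkn (jm q v k i) = jm q v n i := by
  induction i with
  | zero =>
    rw [jm_zero q v hi, jm_zero q v (hi.trans_le hkn), tau, incl,
      RingQuot.liftAlgHom_mkAlgHom_apply, lift_freeTau]
  | succ i ih =>
    rw [jm_succ q v hi, jm_succ q v (hi.trans_le hkn), map_mul, map_mul, incl_sig hkn hi,
      ih (Nat.lt_of_succ_lt hi)]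

theorem sum_jm_mem_centresSubalgebra (q : K) (v : Fin m → K) (hk : 0 < k) (hkn : k ≤ n) :
    ∑ i ∈ Finset.range k, jm q v n i ∈ centresSubalgebra q v n := by
  refine Algebra.subset_adjoin
    ⟨k, hk, hkn, _, (isJMSystem_sig_jm q v hk).sum_J_mem_center hk, ?_⟩
  rw [map_sum]
  exact Finset.sum_congr rfl fun i hi => incl_jm hkn (Finset.mem_range.1 hi)

theorem jmAlgebra_le_centresSubalgebra (q : K) (v : Fin m → K) (n : ℕ) :
    jmAlgebra K (jm q v n) n ≤ centresSubalgebra q v n := by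
  refine Algebra.adjoin_le ?_
  rintro _ ⟨i, hi, rfl⟩
  have sum_succ_mem := sum_jm_mem_centresSubalgebra q v i.succ_pos (Nat.succ_le_of_lt hi)
  rcases i.eq_zero_or_pos with rfl | hi0
  · simpa using sum_succ_mem
  · rw [Finset.sum_range_succ] at sum_succ_mem
    exact (add_mem_cancel_left (sum_jm_mem_centresSubalgebra q v hi0 (le_of_lt hi))).1 sum_succ_mem

theorem map_incl_jmAlgebra_le (q : K) (v : Fin m → K) (hkn : k ≤ n) :
    (jmAlgebra K (jm q v k) k).map (incl q v hkn) ≤ jmAlgebra K (jm q v n) n := by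
  rw [jmAlgebra, AlgHom.map_adjoin]
  refine Algebra.adjoin_le ?_
  rintro _ ⟨_, ⟨i, hi, rfl⟩, rfl⟩
  rw [incl_jm hkn hi]
  exact mem_jmAlgebra (lt_of_lt_of_le hi hkn)

theorem adjoin_jucysMurphySet_eq_centresSubalgebra (hP : SeparatedParameters (q ^ 2) v n) :
    Algebra.adjoin K (jucysMurphySet q v n) = centresSubalgebra q v n := by
  rw [adjoin_jucysMurphySet]
  refine le_antisymm (jmAlgebra_le_centresSubalgebra q v n) (Algebra.adjoin_le ?_)
  rintro _ ⟨k, hk, hkn, z, hz, rfl⟩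
  refine map_incl_jmAlgebra_le q v hkn ⟨z, ?_, rfl⟩
  exact (isJMSystem_sig_jm q v hk).mem_jmAlgebra_of_commute (hP.mono hkn) hk
    fun i _ => (Subalgebra.mem_center_iff.1 hz _).symm

end CyclotomicAlgebra

/-! ### Separation of the numerical and of the generic parameters -/

section Parameters

variable {m n : ℕ}

theorem SemisimpleParameters.separatedParameters {q : ℂ} {v : Fin m → ℂ}
    (h : SemisimpleParameters q v n) (hq : 2 ≤ n → q ^ 2 ≠ 1) :
    SeparatedParameters (q ^ 2) v n where
  Q_ne_zero := pow_ne_zero 2 h.q_ne_zero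
  v_ne_zero := h.v_ne_zero
  pow_ne_one hn i hi hin h_one := by
    have geom_sum := geom_sum_mul (q ^ 2) i
    have sum_ne_zero := h.sum_ne_zero (i - 1) (by omega)
    rw [h_one, sub_self, mul_eq_zero, or_iff_left (_root_.sub_ne_zero.2 (hq hn))] at geom_sum
    rw [Nat.sub_add_cancel hi] at sum_ne_zero
    simp only [pow_mul] at sum_ne_zero
    exact sum_ne_zero geom_sum
  mul_pow_ne i hi j k hjk h_eq := by
    refine h.sub_ne_zero i (by omega) (by omega) j k hjk ?_
    rw [← h_eq, zpow_mul, zpow_natCast, zpow_ofNat, mul_comm, sub_self]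

theorem algebraMap_genericField_ne {p r : MvPolynomial (Option (Fin m)) ℂ}
    (f : Option (Fin m) → ℂ) (h : MvPolynomial.eval f p ≠ MvPolynomial.eval f r) :
    algebraMap _ (GenericField m) p ≠ algebraMap _ (GenericField m) r := fun h_eq =>
  h (congrArg _ (IsFractionRing.injective (MvPolynomial (Option (Fin m)) ℂ) (GenericField m) h_eq))

theorem separatedParameters_generic (m n : ℕ) :
    SeparatedParameters (genericQ m ^ 2) (genericV m) n where
  Q_ne_zero := by
    rw [genericQ, ← map_pow,
      ← map_zero (algebraMap (MvPolynomial (Option (Fin m)) ℂ) (GenericField m))]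
    exact algebraMap_genericField_ne (fun _ => 1) (by simp)
  v_ne_zero j := by
    rw [genericV, ← map_zero (algebraMap (MvPolynomial (Option (Fin m)) ℂ) (GenericField m))]
    exact algebraMap_genericField_ne (fun _ => 1) (by simp)
  pow_ne_one _ i hi _ := by
    rw [genericQ, ← map_pow, ← map_pow,
      ← map_one (algebraMap (MvPolynomial (Option (Fin m)) ℂ) (GenericField m))]
    refine algebraMap_genericField_ne (fun _ => 2) ?_
    simp only [map_pow, MvPolynomial.eval_X, map_one]
    norm_cast
    exact (Nat.one_lt_pow (by omega) (by norm_num)).ne'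
  mul_pow_ne i _ j k hjk := by
    classical
    rw [genericQ, genericV, genericV, ← map_pow, ← map_pow, ← map_mul]
    exact algebraMap_genericField_ne (fun o => if o = some j then 2 else 1) (by simp [hjk.symm])

end Parameters

end CyclotomicHecke

end

theorem mainTheorem4_general {K : Type} [Field K] {m n : ℕ} {q : K} {v : Fin m → K}
    (hP : CyclotomicHecke.SeparatedParameters (q ^ 2) v n) (hn : 1 ≤ n) :
    CyclotomicHecke.JucysMurphyDistinguish q v n ∧
      CyclotomicHecke.IsMaximalCommutativeSet K (CyclotomicHecke.jucysMurphySet q v n) ∧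
      Algebra.adjoin K (CyclotomicHecke.jucysMurphySet q v n) =
        CyclotomicHecke.centresSubalgebra q v n :=
  ⟨CyclotomicHecke.jucysMurphyDistinguish hP hn,
    CyclotomicHecke.isMaximalCommutativeSet_jucysMurphySet hP hn,
    CyclotomicHecke.adjoin_jucysMurphySet_eq_centresSubalgebra hP⟩

theorem mainTheorem4 (m n : ℕ) (hm : 1 ≤ m) (hn : 1 ≤ n) :
    -- numerical parameters, the semisimple situation
    (∀ (q : ℂ) (v : Fin m → ℂ), CyclotomicHecke.SemisimpleParameters q v n →
      (2 ≤ n → q ^ 2 ≠ 1) →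
      CyclotomicHecke.JucysMurphyDistinguish q v n ∧
      CyclotomicHecke.IsMaximalCommutativeSet ℂ (CyclotomicHecke.jucysMurphySet q v n) ∧
      Algebra.adjoin ℂ (CyclotomicHecke.jucysMurphySet q v n) =
        CyclotomicHecke.centresSubalgebra q v n) ∧
    -- the generic algebra, where the parameters are indeterminates
    (CyclotomicHecke.JucysMurphyDistinguish (CyclotomicHecke.genericQ m)
        (CyclotomicHecke.genericV m) n ∧
      CyclotomicHecke.IsMaximalCommutativeSet (CyclotomicHecke.GenericField m)
        (CyclotomicHecke.jucysMurphySet (CyclotomicHecke.genericQ m)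
          (CyclotomicHecke.genericV m) n) ∧
      Algebra.adjoin (CyclotomicHecke.GenericField m)
          (CyclotomicHecke.jucysMurphySet (CyclotomicHecke.genericQ m)
            (CyclotomicHecke.genericV m) n) =
        CyclotomicHecke.centresSubalgebra (CyclotomicHecke.genericQ m)
          (CyclotomicHecke.genericV m) n) := by
  exact ⟨fun _ _ h hq => mainTheorem4_general (h.separatedParameters hq) hn,
    mainTheorem4_general (CyclotomicHecke.separatedParameters_generic m n) hn⟩
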